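/- **Setting.** Let $\mathsf C(x)=\log_2(1+x)$, let $\alpha>0$, let $G_{1D},G_{2D},G_{RD},G_{1R},G_{2R}\ge 0$ be random variables, and let $P_1,P_2,P_R,\bar P_R,\bar G_{RD}\ge 0$ be constants. Put $$\sigma_R=\mathbb E[\mathsf C(G_{1R}P_1+G_{2R}P_2)],\qquad \sigma_D=\mathbb E[\mathsf C(G_{1D}P_1+G_{2D}P_2+G_{RD}P_R)]+\alpha\,\mathsf C(\bar G_{RD}\bar P_R),$$ where both expectations are assumed finite, and $\gamma=2^{(\sigma_D-\sigma_R)/\alpha}$. Let $r_1,r_2,d_1,d_2>0$ be the gains of the relay and direct mm-wave links and $P\ge 0$ the power budget. For powers $(p_1,q_1,p_2,q_2)$ put $$\Sigma_R=\sigma_R+\alpha\sum_{k=1}^2[\log_2(1+r_kq_k)+\log_2(1+d_kp_k)],\qquad \Sigma_D=\sigma_D+\alpha\sum_{k=1}^2\log_2(1+d_kp_k).$$ Problem $[\mathcal P1]$: maximize $R$ subject to $R\le\Sigma_R$, $R\le\Sigma_D$, $p_k+q_k=P$ $(k=1,2)$ and $p_1,q_1,p_2,q_2,R\ge 0$. An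 allocation is called optimal below if $[\mathcal P1]$ has exactly one maximizer, it consists of these powers, and its value is $R=\min\{\Sigma_R,\Sigma_D\}$. **Thresholds.** Let $\varrho[f]$ be the positive root of $f$ in $x$, and $\varrho[f]=0$ if there is none. A quotient $a/0$ is $+\infty$ if $a>0$ and $-\infty$ if $a\le0$ (this concerns only $\bar P_{rd,d}$ and $\bar P_{d,rd}$). Put - $P_{d,d}=r_1^{-1}-d_1^{-1}$, $\hat P_{d,d}=r_2^{-1}-d_2^{-1}$, $P_{r,d}=(\gamma-1)r_1^{-1}$, $P_{d,r}=(\gamma-1)r_2^{-1}$, - $P_{rd,d}=(2\gamma-1)r_1^{-1}-d_1^{-1}$, $P_{d,rd}=(2\gamma-1)r_2^{-1}-d_2^{-1}$, - $P_{r,r}=\varrho[(1+xr_1)(1+xr_2)-\gamma]$, - $P_{r,rd}=\varrho[(1+r_2d_2^{-1}+xr_2)(1+xr_1)-2\gamma]$, $P_{rd,r}=\varrho[(1+r_1d_1^{-1}+xr_1)(1+xr_2)-2\gamma]$, - $P_{rd,rd}=\varrho[(1+r_1d_1^{-1}+xr_1)(1+r_2d_2^{-1}+xr_2)-4\gamma]$,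 - $\bar P_{r,rd}=\varrho[(1+r_2/d_2+xr_2)(1+xr_1)^2-\gamma(1+r_1/d_1+xr_1)]$, $\bar P_{rd,r}=\varrho[(1+r_1/d_1+xr_1)(1+xr_2)^2-\gamma(1+r_2/d_2+xr_2)]$, - $\bar P_{rd,d}=\dfrac{\gamma-1+\gamma r_2d_2^{-1}-r_1d_1^{-1}}{r_1-\gamma r_2}$, $\bar P_{d,rd}=\dfrac{\gamma-1+\gamma r_1d_1^{-1}-r_2d_2^{-1}}{r_2-\gamma r_1}$. Regions of $\boldsymbol r=(r_1,r_2)$: $\mathcal R_{S1}:\ r_1\ge\gamma r_2$; $\mathcal R_1:\ \gamma r_2>r_1\ge r_2$; $\mathcal R_2:\ \gamma r_1>r_2>r_1$; $\mathcal R_{S2}:\ r_2\ge\gamma r_1$. **Regimes and allocations.** Write $w_k=\frac12(P-\frac1{r_k}+\frac1{d_k})$, $q_1^\ast=r_1^{-1}\Big(\gamma\frac{Pr_1+r_1d_1^{-1}+1}{Pr_2+r_2d_2^{-1}+1}\Big)^{1/2}-r_1^{-1}$, $q_2^\ast=r_2^{-1}\Big(\gamma\frac{Pr_2+r_2d_2^{-1}+1}{Pr_1+r_1d_1^{-1}+1}\Big)^{1/2}-r_2^{-1}$.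 In every regime $p_k=P-q_k$, and: - $A_{d,d}$: $0\le P\le\min(P_{d,d},\hat P_{d,d})$; $q_1=0,\ q_2=0$. - $A_{d,r}$: $0\le P\le\min(-\hat P_{d,d},P_{d,d},P_{d,r})$; $q_1=0,\ q_2=P$. - $A_{r,d}$: $0\le P\le\min(-P_{d,d},\hat P_{d,d},P_{r,d})$; $q_1=P,\ q_2=0$. - $A_{r,r}$: $0\le P\le\min(-P_{d,d},-\hat P_{d,d},P_{r,r})$; $q_1=P,\ q_2=P$. - $A_{rd,d}$: $|P_{d,d}|<P\le\min(\hat P_{d,d},P_{rd,d})$; $q_1=w_1,\ q_2=0$. - $A_{d,rd}$: $|\hat P_{d,d}|<P\le\min(P_{d,d},P_{d,rd})$; $q_1=0,\ q_2=w_2$. - $A_{r,rd}$: $|\hat P_{d,d}|<P\le\min(-P_{d,d},P_{r,rd})$; $q_1=P,\ q_2=w_2$. - $A_{rd,r}$: $|P_{d,d}|<P\le\min(-\hat P_{d,d},P_{rd,r})$; $q_1=w_1,\ q_2=P$. - $A_{rd,rd}$: $\max(|P_{d,d}|,|\hat P_{d,d}|)<P\le P_{rd,rd}$; $q_1=w_1,\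 q_2=w_2$. - $S_{r,rd}$: $\max(P_{r,r},P_{r,rd})<P\le\min(\bar P_{r,rd},P_{r,d})$; $q_1=P,\ q_2=r_2^{-1}(\gamma/(1+Pr_1)-1)$. - $S_{rd,r}$: $\max(P_{r,r},P_{rd,r})<P\le\min(\bar P_{rd,r},P_{d,r})$; $q_1=r_1^{-1}(\gamma/(1+Pr_2)-1),\ q_2=P$. - $S_{rd,d}$: $\boldsymbol r\in\mathcal R_{S1}$ and $\max(P_{r,d},P_{rd,d},\bar P_{rd,d})<P$, or $\boldsymbol r\in\mathcal R_1\cup\mathcal R_2\cup\mathcal R_{S2}$ and $\max(P_{r,d},P_{rd,d})<P\le\bar P_{rd,d}$; $q_1=(\gamma-1)r_1^{-1},\ q_2=0$. - $S_{d,rd}$: $\boldsymbol r\in\mathcal R_{S2}$ and $\max(P_{d,r},P_{d,rd},\bar P_{d,rd})<P$, or $\boldsymbol r\in\mathcal R_1\cup\mathcal R_2\cup\mathcal R_{S1}$ and $\max(P_{d,r},P_{d,rd})<P\le\bar P_{d,rd}$; $q_1=0,\ q_2=(\gamma-1)r_2^{-1}$. - $S_{rd,rd}$: $\max(\bar P_{rd,r},\bar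 P_{r,rd},P_{rd,rd})<P$ and one of: $\boldsymbol r\in\mathcal R_1\cup\mathcal R_2$, $\max(\bar P_{rd,d},\bar P_{d,rd})<P$; $\boldsymbol r\in\mathcal R_{S1}$, $\bar P_{d,rd}<P\le\bar P_{rd,d}$; $\boldsymbol r\in\mathcal R_{S2}$, $\bar P_{rd,d}<P\le\bar P_{d,rd}$; $q_1=q_1^\ast,\ q_2=q_2^\ast$. **Theorem.** 1. If $\gamma\le1$, then $(p_1,q_1,p_2,q_2)=(P,0,P,0)$ is the optimal allocation for every $P\ge0$. 2. If $\gamma>1$, then for every $P\ge0$ at least one of the 14 regimes holds, and exactly one if $P>0$ (and also if $P=0$, $r_1\ne d_1$, $r_2\ne d_2$). Whenever a regime holds, its allocation is the optimal one. In the regimes $A$ it satisfies $(1+r_1q_1)(1+r_2q_2)\le\gamma$, in the regimes $S$ it satisfies $(1+r_1q_1)(1+r_2q_2)=\gamma$. 3. Let $\gamma>1$. The final regime is as follows. - If $\boldsymbol r\in\mathcal R_1\cup\mathcal R_2$, then $P_{\rm fin}=\max(\bar P_{rd,d},\bar P_{d,rd},\bar P_{rd,r},\bar P_{r,rd},P_{rd,rd})<\infty$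 and $S_{rd,rd}$ holds for all $P>P_{\rm fin}$. - If $\boldsymbol r\in\mathcal R_{S1}$ and $\bar P_{rd,d}\neq+\infty$ (automatic if $r_1>\gamma r_2$), then $P_{\rm fin}=\max(P_{r,d},P_{rd,d},\bar P_{rd,d})<\infty$ and $S_{rd,d}$ holds for all $P>P_{\rm fin}$. - If $\boldsymbol r\in\mathcal R_{S2}$ and $\bar P_{d,rd}\neq+\infty$ (automatic if $r_2>\gamma r_1$), then $P_{\rm fin}=\max(P_{d,r},P_{d,rd},\bar P_{d,rd})<\infty$ and $S_{d,rd}$ holds for all $P>P_{\rm fin}$. - In the remaining ties ($\boldsymbol r\in\mathcal R_{S1}$, $\bar P_{rd,d}=+\infty$, or $\boldsymbol r\in\mathcal R_{S2}$, $\bar P_{d,rd}=+\infty$), $S_{rd,rd}$ holds for all sufficiently large $P$. -/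

import Mathlib

open MeasureTheory

namespace DRMARC

/-- The function `C(x) = log₂ (1 + x)`. -/
noncomputable def capC (x : ℝ) : ℝ := Real.logb 2 (1 + x)

/-- The microwave band: random link gains of the links source 1 to destination, source 2 to
destination, relay to destination, source 1 to relay, source 2 to relay, and the transmit powers
of the two sources and of the relay. -/
structure MicrowaveBand (Ω : Type*) where
  G1D : Ω → ℝ
  G2D : Ω → ℝ
  GRD : Ω → ℝ
  G1R : Ω → ℝ
  G2R : Ω → ℝ
  P1 : ℝ
  P2 : ℝ
  PR : ℝ

/-- Gains are nonnegative random variables, powers are nonnegative, and the ergodic rates below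
are finite. -/
structure MicrowaveBand.Admissible {Ω : Type*} [MeasurableSpace Ω] (μ : Measure Ω)
    (B : MicrowaveBand Ω) : Prop where
  meas_G1D : Measurable B.G1D
  meas_G2D : Measurable B.G2D
  meas_GRD : Measurable B.GRD
  meas_G1R : Measurable B.G1R
  meas_G2R : Measurable B.G2R
  nonneg_G1D : ∀ ω, 0 ≤ B.G1D ω
  nonneg_G2D : ∀ ω, 0 ≤ B.G2D ω
  nonneg_GRD : ∀ ω, 0 ≤ B.GRD ω
  nonneg_G1R : ∀ ω, 0 ≤ B.G1R ω
  nonneg_G2R : ∀ ω, 0 ≤ B.G2R ω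
  nonneg_P1 : 0 ≤ B.P1
  nonneg_P2 : 0 ≤ B.P2
  nonneg_PR : 0 ≤ B.PR
  integrable_R : Integrable (fun ω => capC (B.G1R ω * B.P1 + B.G2R ω * B.P2)) μ
  integrable_D : Integrable
    (fun ω => capC (B.G1D ω * B.P1 + B.G2D ω * B.P2 + B.GRD ω * B.PR)) μ

/-- `σ_R`. -/
noncomputable def sigmaR {Ω : Type*} [MeasurableSpace Ω] (μ : Measure Ω)
    (B : MicrowaveBand Ω) : ℝ :=
  ∫ ω, capC (B.G1R ω * B.P1 + B.G2R ω * B.P2) ∂μ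

/-- `σ_D`; here `gRD` and `PbarR` are the gain and the relay power of the mm-wave link from the
relay to the destination. -/
noncomputable def sigmaD {Ω : Type*} [MeasurableSpace Ω] (μ : Measure Ω)
    (B : MicrowaveBand Ω) (α gRD PbarR : ℝ) : ℝ :=
  (∫ ω, capC (B.G1D ω * B.P1 + B.G2D ω * B.P2 + B.GRD ω * B.PR) ∂μ) + α * capC (gRD * PbarR)

/-- `γ = 2 ^ ((σ_D - σ_R) / α)`. -/
noncomputable def gammaOf (σR σD α : ℝ) : ℝ := (2 : ℝ) ^ ((σD - σR) / α)

/-- mm-wave gains of the two relay links (`r1`, `r2`) and the two direct links (`d1`, `d2`). -/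
structure LinkGains where
  r1 : ℝ
  r2 : ℝ
  d1 : ℝ
  d2 : ℝ

structure LinkGains.Pos (g : LinkGains) : Prop where
  r1 : 0 < g.r1
  r2 : 0 < g.r2
  d1 : 0 < g.d1
  d2 : 0 < g.d2

/-- Direct link powers `p1`, `p2` and relay link powers `q1`, `q2`. -/
@[ext]
structure Allocation where
  p1 : ℝ
  q1 : ℝ
  p2 : ℝ
  q2 : ℝ

/-! ### The optimization problem -/

/-- `Σ_R`, the sum-rate at the relay. -/
noncomputable def SigmaR (σR α : ℝ) (g : LinkGains) (x : Allocation) : ℝ :=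
  σR + α * ((Real.logb 2 (1 + g.r1 * x.q1) + Real.logb 2 (1 + g.d1 * x.p1))
    + (Real.logb 2 (1 + g.r2 * x.q2) + Real.logb 2 (1 + g.d2 * x.p2)))

/-- `Σ_D`, the sum-rate at the destination. -/
noncomputable def SigmaD (σD α : ℝ) (g : LinkGains) (x : Allocation) : ℝ :=
  σD + α * (Real.logb 2 (1 + g.d1 * x.p1) + Real.logb 2 (1 + g.d2 * x.p2))

/-- Feasibility of `(p1, q1, p2, q2, R)`. -/
structure Feasible (σR σD α : ℝ) (g : LinkGains) (P : ℝ) (x : Allocation) (R : ℝ) : Prop where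
  le_SigmaR : R ≤ SigmaR σR α g x
  le_SigmaD : R ≤ SigmaD σD α g x
  budget1 : x.p1 + x.q1 = P
  budget2 : x.p2 + x.q2 = P
  p1_nonneg : 0 ≤ x.p1
  q1_nonneg : 0 ≤ x.q1
  p2_nonneg : 0 ≤ x.p2
  q2_nonneg : 0 ≤ x.q2
  R_nonneg : 0 ≤ R

/-- `(x, R)` maximizes `R` over the feasible set. -/
def IsSolution (σR σD α : ℝ) (g : LinkGains) (P : ℝ) (x : Allocation) (R : ℝ) : Prop :=
  Feasible σR σD α g P x R ∧ ∀ x' R', Feasible σR σD α g P x' R' → R' ≤ R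

/-- `a` is the optimal allocation: the problem has exactly one solution, its powers are those of
`a` and its value is `min {Σ_R, Σ_D}` at `a`. -/
def IsOptimalAllocation (σR σD α : ℝ) (g : LinkGains) (P : ℝ) (a : Allocation) : Prop :=
  ∀ x R, IsSolution σR σD α g P x R ↔ x = a ∧ R = min (SigmaR σR α g a) (SigmaD σD α g a)

/-! ### Threshold powers -/

/-- The positive root of `f`, and `0` if there is none. (No function it is applied to below has
more than one positive root when the gains are positive and `γ > 1`.) -/
noncomputable def posRoot (f : ℝ → ℝ) : ℝ :=
  open Classical in if h : ∃ x, 0 < x ∧ f x = 0 then h.choose else 0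

section Thresholds

variable (γ : ℝ) (g : LinkGains)

noncomputable def P_d_d : ℝ := g.r1⁻¹ - g.d1⁻¹

noncomputable def Phat_d_d : ℝ := g.r2⁻¹ - g.d2⁻¹

noncomputable def P_r_d : ℝ := (γ - 1) * g.r1⁻¹

noncomputable def P_d_r : ℝ := (γ - 1) * g.r2⁻¹

noncomputable def P_r_r : ℝ := posRoot fun x => (1 + x * g.r1) * (1 + x * g.r2) - γ

noncomputable def P_rd_d : ℝ := (2 * γ - 1) * g.r1⁻¹ - g.d1⁻¹

noncomputable def P_d_rd : ℝ := (2 * γ - 1) * g.r2⁻¹ - g.d2⁻¹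

noncomputable def P_r_rd : ℝ :=
  posRoot fun x => (1 + g.r2 * g.d2⁻¹ + x * g.r2) * (1 + x * g.r1) - 2 * γ

noncomputable def P_rd_r : ℝ :=
  posRoot fun x => (1 + g.r1 * g.d1⁻¹ + x * g.r1) * (1 + x * g.r2) - 2 * γ

noncomputable def P_rd_rd : ℝ :=
  posRoot fun x =>
    (1 + g.r1 * g.d1⁻¹ + x * g.r1) * (1 + g.r2 * g.d2⁻¹ + x * g.r2) - 4 * γ

noncomputable def Pbar_r_rd : ℝ :=
  posRoot fun x =>
    (1 + g.r2 / g.d2 + x * g.r2) * (1 + x * g.r1) ^ 2 - γ * (1 + g.r1 / g.d1 + x * g.r1)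

noncomputable def Pbar_rd_r : ℝ :=
  posRoot fun x =>
    (1 + g.r1 / g.d1 + x * g.r1) * (1 + x * g.r2) ^ 2 - γ * (1 + g.r2 / g.d2 + x * g.r2)

/-- The quotient `a / b`, where `a / 0` is `+∞` for `a > 0` and `-∞` for `a ≤ 0`. -/
noncomputable def extQuot (a b : ℝ) : EReal :=
  open Classical in if b = 0 then (if 0 < a then ⊤ else ⊥) else ((a / b : ℝ) : EReal)

noncomputable def Pbar_rd_d : EReal :=
  extQuot (γ - 1 + γ * g.r2 * g.d2⁻¹ - g.r1 * g.d1⁻¹) (g.r1 - γ * g.r2)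

noncomputable def Pbar_d_rd : EReal :=
  extQuot (γ - 1 + γ * g.r1 * g.d1⁻¹ - g.r2 * g.d2⁻¹) (g.r2 - γ * g.r1)

/-! ### Regions of the relay link gains -/

def RS1 : Prop := γ * g.r2 ≤ g.r1

def R1 : Prop := g.r1 < γ * g.r2 ∧ g.r2 ≤ g.r1

def R2 : Prop := g.r2 < γ * g.r1 ∧ g.r1 < g.r2

def RS2 : Prop := γ * g.r1 ≤ g.r2

end Thresholds

/-! ### Link-gain regimes -/

/-- Names of the 14 link-gain regimes: nine waterfilling-like regimes `A` and five saturation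
regimes `S`. The indices tell the mm-wave links in which source 1 and source 2 transmit. -/
inductive LGR
  | A_d_d
  | A_d_r
  | A_r_d
  | A_r_r
  | A_rd_d
  | A_d_rd
  | A_r_rd
  | A_rd_r
  | A_rd_rd
  | S_r_rd
  | S_rd_r
  | S_rd_d
  | S_d_rd
  | S_rd_rd

/-- The saturation regimes. -/
def LGR.IsSaturation : LGR → Prop
  | .S_r_rd | .S_rd_r | .S_rd_d | .S_d_rd | .S_rd_rd => True
  | _ => False

/-- `ℓ.Holds γ g P` says that the tuple `(r1, r2, d1, d2, P)` lies in the regime `ℓ`. -/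
def LGR.Holds (γ : ℝ) (g : LinkGains) (P : ℝ) : LGR → Prop
  | .A_d_d => 0 ≤ P ∧ P ≤ min (P_d_d g) (Phat_d_d g)
  | .A_d_r => 0 ≤ P ∧ P ≤ min (min (-Phat_d_d g) (P_d_d g)) (P_d_r γ g)
  | .A_r_d => 0 ≤ P ∧ P ≤ min (min (-P_d_d g) (Phat_d_d g)) (P_r_d γ g)
  | .A_r_r => 0 ≤ P ∧ P ≤ min (min (-P_d_d g) (-Phat_d_d g)) (P_r_r γ g)
  | .A_rd_d => max (P_d_d g) (-P_d_d g) < P ∧ P ≤ min (Phat_d_d g) (P_rd_d γ g)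
  | .A_d_rd => max (Phat_d_d g) (-Phat_d_d g) < P ∧ P ≤ min (P_d_d g) (P_d_rd γ g)
  | .A_r_rd => max (Phat_d_d g) (-Phat_d_d g) < P ∧ P ≤ min (-P_d_d g) (P_r_rd γ g)
  | .A_rd_r => max (P_d_d g) (-P_d_d g) < P ∧ P ≤ min (-Phat_d_d g) (P_rd_r γ g)
  | .A_rd_rd =>
      max (max (P_d_d g) (Phat_d_d g)) (max (-P_d_d g) (-Phat_d_d g)) < P ∧ P ≤ P_rd_rd γ g
  | .S_r_rd => max (P_r_r γ g) (P_r_rd γ g) < P ∧ P ≤ min (Pbar_r_rd γ g) (P_r_d γ g)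
  | .S_rd_r => max (P_r_r γ g) (P_rd_r γ g) < P ∧ P ≤ min (Pbar_rd_r γ g) (P_d_r γ g)
  | .S_rd_d =>
      (RS1 γ g ∧ max (P_r_d γ g) (P_rd_d γ g) < P ∧ Pbar_rd_d γ g < (P : EReal)) ∨
      ((R1 γ g ∨ R2 γ g ∨ RS2 γ g) ∧
        max (P_r_d γ g) (P_rd_d γ g) < P ∧ (P : EReal) ≤ Pbar_rd_d γ g)
  | .S_d_rd =>
      (RS2 γ g ∧ max (P_d_r γ g) (P_d_rd γ g) < P ∧ Pbar_d_rd γ g < (P : EReal)) ∨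
      ((R1 γ g ∨ R2 γ g ∨ RS1 γ g) ∧
        max (P_d_r γ g) (P_d_rd γ g) < P ∧ (P : EReal) ≤ Pbar_d_rd γ g)
  | .S_rd_rd =>
      max (max (Pbar_rd_r γ g) (Pbar_r_rd γ g)) (P_rd_rd γ g) < P ∧
      (((R1 γ g ∨ R2 γ g) ∧ max (Pbar_rd_d γ g) (Pbar_d_rd γ g) < (P : EReal)) ∨
       (RS1 γ g ∧ Pbar_d_rd γ g < (P : EReal) ∧ (P : EReal) ≤ Pbar_rd_d γ g) ∨
       (RS2 γ g ∧ Pbar_rd_d γ g < (P : EReal) ∧ (P : EReal) ≤ Pbar_d_rd γ g))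

/-- Two-link power split of source 1: direct link. -/
noncomputable def wp1 (g : LinkGains) (P : ℝ) : ℝ := 1 / 2 * (P + 1 / g.r1 - 1 / g.d1)

/-- Two-link power split of source 1: relay link. -/
noncomputable def wq1 (g : LinkGains) (P : ℝ) : ℝ := 1 / 2 * (P - 1 / g.r1 + 1 / g.d1)

/-- Two-link power split of source 2: direct link. -/
noncomputable def wp2 (g : LinkGains) (P : ℝ) : ℝ := 1 / 2 * (P + 1 / g.r2 - 1 / g.d2)

/-- Two-link power split of source 2: relay link. -/
noncomputable def wq2 (g : LinkGains) (P : ℝ) : ℝ := 1 / 2 * (P - 1 / g.r2 + 1 / g.d2)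

/-- Relay link power of source 1 in the regime `S_rd_rd`. -/
noncomputable def sq1 (γ : ℝ) (g : LinkGains) (P : ℝ) : ℝ :=
  g.r1⁻¹ * Real.sqrt (γ * ((P * g.r1 + g.r1 * g.d1⁻¹ + 1) / (P * g.r2 + g.r2 * g.d2⁻¹ + 1)))
    - g.r1⁻¹

/-- Relay link power of source 2 in the regime `S_rd_rd`. -/
noncomputable def sq2 (γ : ℝ) (g : LinkGains) (P : ℝ) : ℝ :=
  g.r2⁻¹ * Real.sqrt (γ * ((P * g.r2 + g.r2 * g.d2⁻¹ + 1) / (P * g.r1 + g.r1 * g.d1⁻¹ + 1)))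
    - g.r2⁻¹

/-- The closed-form power allocation `(p1, q1, p2, q2)` of each regime. -/
noncomputable def LGR.alloc (γ : ℝ) (g : LinkGains) (P : ℝ) : LGR → Allocation
  | .A_d_d => ⟨P, 0, P, 0⟩
  | .A_d_r => ⟨P, 0, 0, P⟩
  | .A_r_d => ⟨0, P, P, 0⟩
  | .A_r_r => ⟨0, P, 0, P⟩
  | .A_rd_d => ⟨wp1 g P, wq1 g P, P, 0⟩
  | .A_d_rd => ⟨P, 0, wp2 g P, wq2 g P⟩
  | .A_r_rd => ⟨0, P, wp2 g P, wq2 g P⟩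
  | .A_rd_r => ⟨wp1 g P, wq1 g P, 0, P⟩
  | .A_rd_rd => ⟨wp1 g P, wq1 g P, wp2 g P, wq2 g P⟩
  | .S_r_rd =>
      ⟨0, P, P - g.r2⁻¹ * (γ / (1 + P * g.r1) - 1), g.r2⁻¹ * (γ / (1 + P * g.r1) - 1)⟩
  | .S_rd_r =>
      ⟨P - g.r1⁻¹ * (γ / (1 + P * g.r2) - 1), g.r1⁻¹ * (γ / (1 + P * g.r2) - 1), 0, P⟩
  | .S_rd_d => ⟨P - (γ - 1) * g.r1⁻¹, (γ - 1) * g.r1⁻¹, P, 0⟩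
  | .S_d_rd => ⟨P, 0, P - (γ - 1) * g.r2⁻¹, (γ - 1) * g.r2⁻¹⟩
  | .S_rd_rd => ⟨P - sq1 γ g P, sq1 γ g P, P - sq2 γ g P, sq2 γ g P⟩

/-- `(1 + r1 q1) (1 + r2 q2)`. -/
def relayProduct (g : LinkGains) (x : Allocation) : ℝ :=
  (1 + g.r1 * x.q1) * (1 + g.r2 * x.q2)

/-! ### Thresholds of the final regimes -/

noncomputable def Pfin_rd_rd (γ : ℝ) (g : LinkGains) : EReal :=
  max (max (Pbar_rd_d γ g) (Pbar_d_rd γ g))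
    ((max (max (Pbar_rd_r γ g) (Pbar_r_rd γ g)) (P_rd_rd γ g) : ℝ) : EReal)

noncomputable def Pfin_rd_d (γ : ℝ) (g : LinkGains) : EReal :=
  max ((max (P_r_d γ g) (P_rd_d γ g) : ℝ) : EReal) (Pbar_rd_d γ g)

noncomputable def Pfin_d_rd (γ : ℝ) (g : LinkGains) : EReal :=
  max ((max (P_d_r γ g) (P_d_rd γ g) : ℝ) : EReal) (Pbar_d_rd γ g)

end DRMARC

open DRMARC

/-!
Since `σ_D - σ_R = α log₂ γ`, the best rate for given powers is, up to constants, the logarithm of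
`min {(1 + r₁ q₁) (1 + r₂ q₂), γ} * (1 + d₁ p₁) (1 + d₂ p₂)`. This is a concave function of
`(q₁, q₂)` on the square `[0, P]²`, so a point satisfying the Kuhn–Tucker conditions is its strict
maximizer. The multiplier is a supergradient `t ∈ [0, 1]` of the minimum: `t = 0` for `γ ≤ 1`,
`t = 1` in the regimes `A` (waterfilling), and a value in between on the saturation curve
`(1 + r₁ q₁) (1 + r₂ q₂) = γ` (`isOptimalAllocation_of_stationary`).

In the variables `u_k = 1 + r_k q_k ∈ [1, U_k]` one maximizes `min {u₁ u₂, γ} (T₁ - u₁) (T₂ - u₂)`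
with `U_k = 1 + r_k P` and `T_k = 1 + r_k / d_k + r_k P`. Every threshold of a regime then becomes a
polynomial inequality in `U_k`, `T_k` and `γ` (`LGR.holds_iff_normal`); for the thresholds defined
by roots, this uses that the function in question changes sign only once. Each source alone would
choose the level `v_k`, the projection of `T_k / 2` to `[1, U_k]`. The regimes `A` enumerate the
positions of `v_1`, `v_2` in the case `v₁ v₂ ≤ γ`. In the case `v₁ v₂ > γ` one minimizes
`T₁ u₂ + T₂ u₁` on the hyperbola `u₁ u₂ = γ`, and the regimes `S` enumerate the positions of its
minimizer `u₁ = (γ T₁ / T₂)^(1/2)` relative to the box (`LGR.existsUnique_normal`). For `P = 0` only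
four regimes are possible (`LGR.holds_zero_iff`).

Half of the statements are obtained from the other half by interchanging the two sources
(`LinkGains.swap`).
-/

namespace DRMARC

/-! ### Optimality from a multiplier -/

/-- The Kuhn–Tucker condition for the relay power `q` of one source with budget `P` and multiplier
`t`: the derivative of `t * log (1 + r * q) + log (1 + d * (P - q))`, cleared of its positive
denominators, does not point into `[0, P]`. -/
structure LinkStationary (r d P t q : ℝ) : Prop where
  nonneg : 0 ≤ q
  le : q ≤ P
  slope : ∀ x, 0 ≤ x → x ≤ P → (t * (r * (1 + d * (P - q))) - d * (1 + r * q)) * (x - q) ≤ 0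

section Link

variable {r d P t : ℝ}

theorem LinkStationary.zero (hP : 0 ≤ P) (h : t * (r * (1 + d * P)) ≤ d) :
    LinkStationary r d P t 0 where
  nonneg := le_rfl
  le := hP
  slope x hx _ := mul_nonpos_of_nonpos_of_nonneg (by simpa using h) (by simpa using hx)

theorem LinkStationary.full (hP : 0 ≤ P) (h : d * (1 + r * P) ≤ t * r) :
    LinkStationary r d P t P where
  nonneg := hP
  le := le_rfl
  slope x _ hx := mul_nonpos_of_nonneg_of_nonpos (by simpa using h) (by linarith)

theorem LinkStationary.interior {q : ℝ} (h0 : 0 ≤ q) (h1 : q ≤ P)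
    (h : t * (r * (1 + d * (P - q))) = d * (1 + r * q)) : LinkStationary r d P t q where
  nonneg := h0
  le := h1
  slope x _ _ := by rw [h, sub_self, zero_mul]

/-- Concavity of the logarithm turns the Kuhn–Tucker condition into strict optimality. -/
theorem LinkStationary.log_lt {q x : ℝ} (hr : 0 < r) (hd : 0 < d) (ht : 0 ≤ t)
    (h : LinkStationary r d P t q) (hx0 : 0 ≤ x) (hxP : x ≤ P) (hne : x ≠ q) :
    t * Real.log (1 + r * x) + Real.log (1 + d * (P - x)) <
      t * Real.log (1 + r * q) + Real.log (1 + d * (P - q)) := by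
  have hq := h.nonneg
  have hqP := h.le
  have a0 : 0 < 1 + r * q := by positivity
  have a1 : 0 < 1 + r * x := by positivity
  have b0 : 0 < 1 + d * (P - q) := by
    have := mul_nonneg hd.le (sub_nonneg.2 hqP); linarith
  have b1 : 0 < 1 + d * (P - x) := by
    have := mul_nonneg hd.le (sub_nonneg.2 hxP); linarith
  have ha := Real.log_le_sub_one_of_pos (div_pos a1 a0)
  have hb : Real.log ((1 + d * (P - x)) / (1 + d * (P - q))) <
      (1 + d * (P - x)) / (1 + d * (P - q)) - 1 := by
    refine Real.log_lt_sub_one_of_pos (div_pos b1 b0) fun he => hne ?_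
    rw [div_eq_one_iff_eq b0.ne'] at he
    have : d * (x - q) = 0 := by linarith
    have := (mul_eq_zero.1 this).resolve_left hd.ne'
    linarith
  rw [Real.log_div a1.ne' a0.ne'] at ha
  rw [Real.log_div b1.ne' b0.ne'] at hb
  have key : t * ((1 + r * x) / (1 + r * q) - 1) + ((1 + d * (P - x)) / (1 + d * (P - q)) - 1)
      = (t * (r * (1 + d * (P - q))) - d * (1 + r * q)) * (x - q) /
        ((1 + r * q) * (1 + d * (P - q))) := by
    field_simp
    ring
  have hs := div_nonpos_of_nonpos_of_nonneg (h.slope x hx0 hxP) (mul_pos a0 b0).le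
  rw [← key] at hs
  have := mul_le_mul_of_nonneg_left ha ht
  linarith

end Link

/-- `t` is a supergradient of `a ↦ min a γ` at `w`: it is `1` if `w < γ`, `0` if `γ < w`, and any
number in `[0, 1]` if `w = γ`. -/
def Slackness (γ w t : ℝ) : Prop :=
  (t = 1 ∧ w ≤ γ) ∨ (0 ≤ t ∧ t ≤ 1 ∧ w = γ) ∨ (t = 0 ∧ γ ≤ w)

theorem Slackness.nonneg {γ w t : ℝ} (h : Slackness γ w t) : 0 ≤ t := by
  rcases h with ⟨rfl, _⟩ | ⟨h, _⟩ | ⟨rfl, _⟩ <;> simp [*]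

theorem Slackness.min_sub_le {c a₀ t : ℝ} (h : Slackness c a₀ t) (a : ℝ) :
    min a c - t * a ≤ min a₀ c - t * a₀ := by
  rcases h with ⟨rfl, h⟩ | ⟨h0, h1, rfl⟩ | ⟨rfl, h⟩
  · rw [min_eq_left h]; linarith [min_le_left a c]
  · rw [min_self]
    have h2 := mul_le_mul_of_nonneg_left (min_le_left a a₀) h0
    have h3 := mul_le_mul_of_nonneg_left (min_le_right a a₀) (sub_nonneg.2 h1)
    linarith
  · rw [min_eq_right h]; linarith [min_le_right a c]

theorem Slackness.log {γ w t : ℝ} (hγ : 0 < γ) (hw : 0 < w) (h : Slackness γ w t) :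
    Slackness (Real.log γ) (Real.log w) t := by
  rcases h with ⟨rfl, h⟩ | ⟨h0, h1, rfl⟩ | ⟨rfl, h⟩
  · exact Or.inl ⟨rfl, Real.log_le_log hw h⟩
  · exact Or.inr (Or.inl ⟨h0, h1, rfl⟩)
  · exact Or.inr (Or.inr ⟨rfl, Real.log_le_log hγ h⟩)

/-- Feasibility of the powers alone: both budgets are spent and no power is negative. -/
structure PowerFeasible (P : ℝ) (x : Allocation) : Prop where
  budget1 : x.p1 + x.q1 = P
  budget2 : x.p2 + x.q2 = P
  p1_nonneg : 0 ≤ x.p1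
  q1_nonneg : 0 ≤ x.q1
  p2_nonneg : 0 ≤ x.p2
  q2_nonneg : 0 ≤ x.q2

theorem Feasible.powerFeasible {σR σD α P R : ℝ} {g : LinkGains} {x : Allocation}
    (h : Feasible σR σD α g P x R) : PowerFeasible P x :=
  ⟨h.budget1, h.budget2, h.p1_nonneg, h.q1_nonneg, h.p2_nonneg, h.q2_nonneg⟩

theorem SigmaR_nonneg {σR α P : ℝ} {g : LinkGains} {x : Allocation} (hg : g.Pos) (hα : 0 < α)
    (hσ : 0 ≤ σR) (hx : PowerFeasible P x) : 0 ≤ SigmaR σR α g x := by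
  have l : ∀ {a b : ℝ}, 0 < a → 0 ≤ b → 0 ≤ Real.logb 2 (1 + a * b) := fun ha hb =>
    Real.logb_nonneg (by norm_num) (by have := mul_nonneg ha.le hb; linarith)
  have h1 := l hg.r1 hx.q1_nonneg
  have h2 := l hg.d1 hx.p1_nonneg
  have h3 := l hg.r2 hx.q2_nonneg
  have h4 := l hg.d2 hx.p2_nonneg
  unfold SigmaR
  positivity

theorem SigmaD_nonneg {σD α P : ℝ} {g : LinkGains} {x : Allocation} (hg : g.Pos) (hα : 0 < α)
    (hσ : 0 ≤ σD) (hx : PowerFeasible P x) : 0 ≤ SigmaD σD α g x := by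
  have l : ∀ {a b : ℝ}, 0 < a → 0 ≤ b → 0 ≤ Real.logb 2 (1 + a * b) := fun ha hb =>
    Real.logb_nonneg (by norm_num) (by have := mul_nonneg ha.le hb; linarith)
  have h2 := l hg.d1 hx.p1_nonneg
  have h4 := l hg.d2 hx.p2_nonneg
  unfold SigmaD
  positivity

/-- The value of the problem is attained at `R = min {Σ_R, Σ_D}`, so a strict maximizer of this
minimum is the optimal allocation. -/
theorem isOptimalAllocation_of_min_lt {σR σD α P : ℝ} {g : LinkGains} {a : Allocation}
    (hg : g.Pos) (hα : 0 < α) (hσR : 0 ≤ σR) (hσD : 0 ≤ σD) (ha : PowerFeasible P a)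
    (hlt : ∀ x, PowerFeasible P x → x ≠ a →
      min (SigmaR σR α g x) (SigmaD σD α g x) < min (SigmaR σR α g a) (SigmaD σD α g a)) :
    IsOptimalAllocation σR σD α g P a := by
  have hfa : Feasible σR σD α g P a (min (SigmaR σR α g a) (SigmaD σD α g a)) :=
    ⟨min_le_left _ _, min_le_right _ _, ha.budget1, ha.budget2, ha.p1_nonneg, ha.q1_nonneg,
      ha.p2_nonneg, ha.q2_nonneg, le_min (SigmaR_nonneg hg hα hσR ha) (SigmaD_nonneg hg hα hσD ha)⟩
  intro x R
  constructor
  · rintro ⟨hx, hmax⟩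
    have h1 := hmax _ _ hfa
    have h2 : R ≤ min (SigmaR σR α g x) (SigmaD σD α g x) := le_min hx.le_SigmaR hx.le_SigmaD
    have hxa : x = a := by
      by_contra hne
      exact absurd (hlt x hx.powerFeasible hne) (not_lt.2 (h1.trans h2))
    subst hxa
    exact ⟨rfl, le_antisymm h2 h1⟩
  · rintro ⟨rfl, rfl⟩
    refine ⟨hfa, fun x' R' h' => ?_⟩
    have h2 := le_min h'.le_SigmaR h'.le_SigmaD
    by_cases hne : x' = x
    · rwa [hne] at h2
    · exact h2.trans (hlt x' h'.powerFeasible hne).le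

/-- By the choice of `γ`, the two sum-rates differ only in that the logarithm of the relay product
is replaced by `log γ`. -/
theorem min_Sigma_eq {σR σD α γ P : ℝ} {g : LinkGains} {x : Allocation} (hg : g.Pos) (hα : 0 < α)
    (hγ : γ = gammaOf σR σD α) (hx : PowerFeasible P x) :
    min (SigmaR σR α g x) (SigmaD σD α g x) = σR + α / Real.log 2 *
      (min (Real.log (relayProduct g x)) (Real.log γ) +
        (Real.log (1 + g.d1 * x.p1) + Real.log (1 + g.d2 * x.p2))) := by
  have h2 : 0 < Real.log 2 := Real.log_pos (by norm_num)
  have hlogγ : Real.log γ = (σD - σR) / α * Real.log 2 := by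
    rw [hγ, gammaOf, Real.log_rpow (by norm_num)]
  have hu1 : 0 < 1 + g.r1 * x.q1 := by have := mul_nonneg hg.r1.le hx.q1_nonneg; linarith
  have hu2 : 0 < 1 + g.r2 * x.q2 := by have := mul_nonneg hg.r2.le hx.q2_nonneg; linarith
  have hR : SigmaR σR α g x = σR + α / Real.log 2 * (Real.log (relayProduct g x) +
      (Real.log (1 + g.d1 * x.p1) + Real.log (1 + g.d2 * x.p2))) := by
    rw [relayProduct, Real.log_mul hu1.ne' hu2.ne']
    simp only [SigmaR, Real.logb]
    ring
  have hD : SigmaD σD α g x = σR + α / Real.log 2 * (Real.log γ +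
      (Real.log (1 + g.d1 * x.p1) + Real.log (1 + g.d2 * x.p2))) := by
    rw [hlogγ]
    simp only [SigmaD, Real.logb]
    field_simp
    ring
  rw [hR, hD, ← min_add_add_right, mul_min_of_nonneg _ _ (by positivity), ← min_add_add_left]

/-- Sufficiency of the Kuhn–Tucker conditions: all optimality claims follow from this one, by a
choice of the multiplier `t`. -/
theorem isOptimalAllocation_of_stationary {σR σD α γ P t : ℝ} {g : LinkGains} {a : Allocation}
    (hg : g.Pos) (hα : 0 < α) (hσR : 0 ≤ σR) (hσD : 0 ≤ σD) (hγ : γ = gammaOf σR σD α)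
    (hp1 : a.p1 = P - a.q1) (hp2 : a.p2 = P - a.q2)
    (h1 : LinkStationary g.r1 g.d1 P t a.q1) (h2 : LinkStationary g.r2 g.d2 P t a.q2)
    (hs : Slackness γ (relayProduct g a) t) :
    IsOptimalAllocation σR σD α g P a := by
  have pos : ∀ {x : Allocation}, PowerFeasible P x →
      0 < 1 + g.r1 * x.q1 ∧ 0 < 1 + g.r2 * x.q2 := fun hx =>
    ⟨by have := mul_nonneg hg.r1.le hx.q1_nonneg; linarith,
      by have := mul_nonneg hg.r2.le hx.q2_nonneg; linarith⟩
  have ha : PowerFeasible P a :=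
    ⟨by linarith, by linarith, by linarith [h1.le], h1.nonneg, by linarith [h2.le], h2.nonneg⟩
  have hγ0 : 0 < γ := by rw [hγ, gammaOf]; positivity
  refine isOptimalAllocation_of_min_lt hg hα hσR hσD ha fun x hx hne => ?_
  rw [min_Sigma_eq hg hα hγ hx, min_Sigma_eq hg hα hγ ha]
  have hc : 0 < α / Real.log 2 := div_pos hα (Real.log_pos (by norm_num))
  have hxp1 : x.p1 = P - x.q1 := by linarith [hx.budget1]
  have hxp2 : x.p2 = P - x.q2 := by linarith [hx.budget2]
  have hwa : 0 < relayProduct g a := mul_pos (pos ha).1 (pos ha).2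
  have hmin := (hs.log hγ0 hwa).min_sub_le
    (Real.log (relayProduct g x))
  have e : ∀ {y : Allocation}, PowerFeasible P y → Real.log (relayProduct g y) =
      Real.log (1 + g.r1 * y.q1) + Real.log (1 + g.r2 * y.q2) := fun hy => by
    rw [relayProduct, Real.log_mul (pos hy).1.ne' (pos hy).2.ne']
  have l1 := h1.log_lt hg.r1 hg.d1 hs.nonneg hx.q1_nonneg (by linarith [hx.p1_nonneg])
  have l2 := h2.log_lt hg.r2 hg.d2 hs.nonneg hx.q2_nonneg (by linarith [hx.p2_nonneg])
  rw [← hxp1, ← hp1] at l1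
  rw [← hxp2, ← hp2] at l2
  have hsum : t * Real.log (relayProduct g x) +
      (Real.log (1 + g.d1 * x.p1) + Real.log (1 + g.d2 * x.p2)) <
      t * Real.log (relayProduct g a) +
      (Real.log (1 + g.d1 * a.p1) + Real.log (1 + g.d2 * a.p2)) := by
    rw [e hx, e ha]
    by_cases hq1 : x.q1 = a.q1
    · have hq2 : x.q2 ≠ a.q2 := fun hq2 => hne <|
        Allocation.ext (by rw [hxp1, hp1, hq1]) hq1 (by rw [hxp2, hp2, hq2]) hq2
      rw [show x.p1 = a.p1 by rw [hxp1, hp1, hq1], hq1]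
      linarith [l2 hq2]
    · by_cases hq2 : x.q2 = a.q2
      · rw [show x.p2 = a.p2 by rw [hxp2, hp2, hq2], hq2]
        linarith [l1 hq1]
      · linarith [l1 hq1, l2 hq2]
  have : min (Real.log (relayProduct g x)) (Real.log γ) +
        (Real.log (1 + g.d1 * x.p1) + Real.log (1 + g.d2 * x.p2)) <
      min (Real.log (relayProduct g a)) (Real.log γ) +
        (Real.log (1 + g.d1 * a.p1) + Real.log (1 + g.d2 * a.p2)) := by linarith
  linarith [mul_lt_mul_of_pos_left this hc]

/-! ### Nonnegativity of the microwave rates -/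

theorem capC_nonneg {x : ℝ} (hx : 0 ≤ x) : 0 ≤ capC x :=
  Real.logb_nonneg (by norm_num) (by linarith)

theorem sigmaR_nonneg {Ω : Type*} [MeasurableSpace Ω] (μ : Measure Ω) {B : MicrowaveBand Ω}
    (hB : B.Admissible μ) : 0 ≤ sigmaR μ B :=
  integral_nonneg fun ω => capC_nonneg <| add_nonneg
    (mul_nonneg (hB.nonneg_G1R ω) hB.nonneg_P1) (mul_nonneg (hB.nonneg_G2R ω) hB.nonneg_P2)

theorem sigmaD_nonneg {Ω : Type*} [MeasurableSpace Ω] (μ : Measure Ω) {B : MicrowaveBand Ω}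
    (hB : B.Admissible μ) {α gRD PbarR : ℝ} (hα : 0 < α) (hgRD : 0 ≤ gRD) (hPbarR : 0 ≤ PbarR) :
    0 ≤ sigmaD μ B α gRD PbarR :=
  add_nonneg
    (integral_nonneg fun ω => capC_nonneg <| add_nonneg (add_nonneg
      (mul_nonneg (hB.nonneg_G1D ω) hB.nonneg_P1) (mul_nonneg (hB.nonneg_G2D ω) hB.nonneg_P2))
      (mul_nonneg (hB.nonneg_GRD ω) hB.nonneg_PR))
    (mul_nonneg hα.le (capC_nonneg (mul_nonneg hgRD hPbarR)))

/-! ### Comparing a budget with a threshold -/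

theorem posRoot_nonneg (f : ℝ → ℝ) : 0 ≤ posRoot f := by
  unfold posRoot
  split_ifs with h
  · exact h.choose_spec.1.le
  · exact le_rfl

/-- If `f` is positive to the right of every point where it is nonnegative, and is positive
somewhere, then `posRoot f` separates the signs of `f`, also when `f` has no positive root. -/
theorem posRoot_lt_iff {f : ℝ → ℝ} (hc : Continuous f)
    (hm : ∀ x y, 0 ≤ x → x < y → 0 ≤ f x → 0 < f y) (hpos : ∃ y, 0 ≤ y ∧ 0 < f y)
    {P : ℝ} (hP : 0 < P) : posRoot f < P ↔ 0 < f P := by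
  unfold posRoot
  split_ifs with h
  · obtain ⟨h0, h1⟩ := h.choose_spec
    refine ⟨fun hlt => hm _ _ h0.le hlt h1.ge, fun hf => ?_⟩
    by_contra! hle
    rcases hle.eq_or_lt with he | hlt
    · rw [he] at hf; linarith
    · have := hm _ _ hP.le hlt hf.le; linarith
  · refine ⟨fun _ => ?_, fun _ => hP⟩
    by_contra! hf
    obtain ⟨y, hy0, hy⟩ := hpos
    have hPy : P ≤ y := by
      by_contra! hlt
      have := hm _ _ hy0 hlt hy.le
      linarith
    obtain ⟨c, hc1, hc2⟩ := intermediate_value_Icc hPy hc.continuousOn ⟨hf, hy.le⟩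
    exact h ⟨c, hP.trans_le hc1.1, hc2⟩

theorem posRoot_mul_lt_iff {a b r r' c P : ℝ} (ha : 1 ≤ a) (hb : 1 ≤ b) (hr : 0 < r) (hr' : 0 < r')
    (hc : 0 < c) (hP : 0 < P) :
    posRoot (fun x => (a + x * r) * (b + x * r') - c) < P ↔ c < (a + P * r) * (b + P * r') := by
  rw [posRoot_lt_iff (by fun_prop) _ _ hP, sub_pos]
  · intro x y hx hxy h
    have h1 := mul_lt_mul_of_pos_right hxy hr
    have h2 := mul_lt_mul_of_pos_right hxy hr'
    have h3 := mul_nonneg hx hr.le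
    have h4 := mul_nonneg hx hr'.le
    have : (a + x * r) * (b + x * r') < (a + y * r) * (b + y * r') :=
      mul_lt_mul'' (by linarith) (by linarith) (by linarith) (by linarith)
    linarith
  · refine ⟨c / r, by positivity, ?_⟩
    rw [div_mul_cancel₀ _ hr.ne']
    have h4 : 0 ≤ c / r * r' := by positivity
    have : (a + c) * 1 ≤ (a + c) * (b + c / r * r') :=
      mul_le_mul_of_nonneg_left (by linarith) (by linarith)
    linarith

theorem posRoot_ratio_lt_iff {s s' r r' γ P : ℝ} (hs : 0 < s) (hs' : 0 < s') (hr : 0 < r)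
    (hr' : 0 < r') (hγ : 0 < γ) (hP : 0 < P) :
    posRoot (fun x => (1 + s' + x * r') * (1 + x * r) ^ 2 - γ * (1 + s + x * r)) < P ↔
      γ * (1 + s + P * r) < (1 + s' + P * r') * (1 + P * r) ^ 2 := by
  rw [posRoot_lt_iff (by fun_prop) _ _ hP, sub_pos]
  · intro x y hx hxy h
    have h1 := mul_lt_mul_of_pos_right hxy hr
    have h2 := mul_lt_mul_of_pos_right hxy hr'
    have h3 := mul_nonneg hx hr.le
    have h4 := mul_nonneg hx hr'.le
    -- `(1 + x r) / (1 + s + x r)` increases with `x`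
    have hratio : (1 + x * r) * (1 + s + y * r) < (1 + y * r) * (1 + s + x * r) := by
      have := mul_lt_mul_of_pos_left h1 hs
      linarith
    have hA : (1 + s' + x * r') * (1 + x * r) < (1 + s' + y * r') * (1 + y * r) :=
      mul_lt_mul'' (by linarith) (by linarith) (by linarith) (by linarith)
    have hprod : ((1 + s' + x * r') * (1 + x * r)) * ((1 + x * r) * (1 + s + y * r)) <
        ((1 + s' + y * r') * (1 + y * r)) * ((1 + y * r) * (1 + s + x * r)) :=
      mul_lt_mul'' hA hratio (mul_nonneg (by linarith) (by linarith))
        (mul_nonneg (by linarith) (by linarith))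
    have hT : 0 ≤ 1 + s + y * r := by linarith
    have hx' := mul_le_mul_of_nonneg_right (sub_nonneg.1 h) hT
    have hTx : 0 < 1 + s + x * r := by linarith
    refine sub_pos.2 (lt_of_mul_lt_mul_right ?_ hTx.le)
    calc γ * (1 + s + y * r) * (1 + s + x * r) = γ * (1 + s + x * r) * (1 + s + y * r) := by ring
      _ ≤ _ := hx'
      _ = ((1 + s' + x * r') * (1 + x * r)) * ((1 + x * r) * (1 + s + y * r)) := by ring
      _ < _ := hprod
      _ = _ := by ring
  · refine ⟨γ * (1 + s) / r, by positivity, ?_⟩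
    rw [div_mul_cancel₀ _ hr.ne']
    have h0 : 0 < γ * (1 + s) / r * r' := by positivity
    have h1 : 0 < γ * s := by positivity
    have h2 : 1 * (1 + γ * (1 + s)) ^ 2 ≤
        (1 + s' + γ * (1 + s) / r * r') * (1 + γ * (1 + s)) ^ 2 :=
      mul_le_mul_of_nonneg_right (by linarith) (by positivity)
    nlinarith [mul_pos h1 hγ, mul_pos h1 h1]

theorem extQuot_of_ne {a b : ℝ} (hb : b ≠ 0) : extQuot a b = ((a / b : ℝ) : EReal) := if_neg hb

/-- The two sources interchanged. -/
def LinkGains.swap (g : LinkGains) : LinkGains := ⟨g.r2, g.r1, g.d2, g.d1⟩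

theorem LinkGains.Pos.swap {g : LinkGains} (hg : g.Pos) : g.swap.Pos := ⟨hg.r2, hg.r1, hg.d2, hg.d1⟩

/-- The budget lies on the side of the threshold `Pbar_rd_d` on which, once the relay constraint
is active, only source 1 uses its relay link. -/
def OnlySourceOne (γ : ℝ) (g : LinkGains) (P : ℝ) : Prop :=
  (RS1 γ g ∧ Pbar_rd_d γ g < (P : EReal)) ∨ (¬ RS1 γ g ∧ (P : EReal) ≤ Pbar_rd_d γ g)

/-- `1 + r₁ P`, the largest possible value of `1 + r₁ q₁`. -/
noncomputable def relayMax (g : LinkGains) (P : ℝ) : ℝ := 1 + P * g.r1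

/-- `1 + r₁ / d₁ + r₁ P`: in the variable `u = 1 + r₁ q₁`, the direct link factor `1 + d₁ p₁`
is proportional to `linkTotal g P - u`. -/
noncomputable def linkTotal (g : LinkGains) (P : ℝ) : ℝ := 1 + g.r1 / g.d1 + P * g.r1

theorem linkTotal_sub_eq (γ : ℝ) (g : LinkGains) (P : ℝ) :
    γ * linkTotal g.swap P - linkTotal g P =
      (γ - 1 + γ * g.r2 * g.d2⁻¹ - g.r1 * g.d1⁻¹) - P * (g.r1 - γ * g.r2) := by
  simp only [linkTotal, LinkGains.swap, div_eq_mul_inv]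
  ring

theorem OnlySourceOne.le {γ P : ℝ} {g : LinkGains} (h : OnlySourceOne γ g P) :
    γ * linkTotal g.swap P ≤ linkTotal g P := by
  rw [← sub_nonpos, linkTotal_sub_eq]
  unfold OnlySourceOne RS1 Pbar_rd_d at h
  rcases h with ⟨h1, h2⟩ | ⟨h1, h2⟩
  · rcases h1.eq_or_lt with h1 | h1
    · have hb : g.r1 - γ * g.r2 = 0 := by linarith
      rw [hb, extQuot, if_pos rfl] at h2
      split_ifs at h2 with h3
      · exact absurd h2 not_top_lt
      · rw [hb]; linarith
    · rw [extQuot_of_ne (by linarith), EReal.coe_lt_coe_iff, div_lt_iff₀ (by linarith)] at h2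
      linarith
  · rw [not_le] at h1
    rw [extQuot_of_ne (by linarith), EReal.coe_le_coe_iff, le_div_iff_of_neg (by linarith)] at h2
    linarith

theorem onlySourceOne_of_lt {γ P : ℝ} {g : LinkGains}
    (h : γ * linkTotal g.swap P < linkTotal g P) : OnlySourceOne γ g P := by
  rw [← sub_neg, linkTotal_sub_eq] at h
  unfold OnlySourceOne RS1 Pbar_rd_d
  by_cases h1 : γ * g.r2 ≤ g.r1
  · refine Or.inl ⟨h1, ?_⟩
    rcases h1.eq_or_lt with h1 | h1
    · have hb : g.r1 - γ * g.r2 = 0 := by linarith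
      rw [hb] at h
      rw [hb, extQuot, if_pos rfl, if_neg (by linarith)]
      exact EReal.bot_lt_coe P
    · rw [extQuot_of_ne (by linarith), EReal.coe_lt_coe_iff, div_lt_iff₀ (by linarith)]
      linarith
  · refine Or.inr ⟨h1, ?_⟩
    rw [not_le] at h1
    rw [extQuot_of_ne (by linarith), EReal.coe_le_coe_iff, le_div_iff_of_neg (by linarith)]
    linarith

/-! ### Regimes in normalized coordinates -/

/-- The regimes for a positive budget, in terms of the ranges `1 ≤ u_k ≤ U_k` of the variables
`u_k = 1 + r_k q_k` and of `T_k`, where `u_k (T_k - u_k)` is proportional to the product of the two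
link factors of source `k`. `D_k` says that in saturation only source `k` uses its relay link. -/
def LGR.Normal (γ U₁ T₁ U₂ T₂ : ℝ) (D₁ D₂ : Prop) : LGR → Prop
  | .A_d_d => T₁ ≤ 2 ∧ T₂ ≤ 2
  | .A_d_r => 2 * U₂ ≤ T₂ ∧ T₁ ≤ 2 ∧ U₂ ≤ γ
  | .A_r_d => 2 * U₁ ≤ T₁ ∧ T₂ ≤ 2 ∧ U₁ ≤ γ
  | .A_r_r => 2 * U₁ ≤ T₁ ∧ 2 * U₂ ≤ T₂ ∧ U₁ * U₂ ≤ γ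
  | .A_rd_d => 2 < T₁ ∧ T₁ < 2 * U₁ ∧ T₂ ≤ 2 ∧ T₁ ≤ 2 * γ
  | .A_d_rd => 2 < T₂ ∧ T₂ < 2 * U₂ ∧ T₁ ≤ 2 ∧ T₂ ≤ 2 * γ
  | .A_r_rd => 2 < T₂ ∧ T₂ < 2 * U₂ ∧ 2 * U₁ ≤ T₁ ∧ T₂ * U₁ ≤ 2 * γ
  | .A_rd_r => 2 < T₁ ∧ T₁ < 2 * U₁ ∧ 2 * U₂ ≤ T₂ ∧ T₁ * U₂ ≤ 2 * γ
  | .A_rd_rd => 2 < T₁ ∧ 2 < T₂ ∧ T₁ < 2 * U₁ ∧ T₂ < 2 * U₂ ∧ T₁ * T₂ ≤ 4 * γ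
  | .S_r_rd => γ < U₁ * U₂ ∧ 2 * γ < T₂ * U₁ ∧ T₂ * U₁ ^ 2 ≤ γ * T₁ ∧ U₁ ≤ γ
  | .S_rd_r => γ < U₁ * U₂ ∧ 2 * γ < T₁ * U₂ ∧ T₁ * U₂ ^ 2 ≤ γ * T₂ ∧ U₂ ≤ γ
  | .S_rd_d => γ < U₁ ∧ 2 * γ < T₁ ∧ D₁
  | .S_d_rd => γ < U₂ ∧ 2 * γ < T₂ ∧ D₂
  | .S_rd_rd => γ * T₂ < T₁ * U₂ ^ 2 ∧ γ * T₁ < T₂ * U₁ ^ 2 ∧ 4 * γ < T₁ * T₂ ∧ ¬ D₁ ∧ ¬ D₂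

section Thresholds

variable {γ P : ℝ} {g : LinkGains}

theorem le_P_d_d_iff (hg : g.Pos) : P ≤ P_d_d g ↔ linkTotal g P ≤ 2 := by
  have := hg.r1
  rw [← mul_le_mul_iff_left₀ hg.r1, P_d_d, linkTotal, sub_mul, inv_mul_cancel₀ hg.r1.ne',
    div_eq_inv_mul]
  constructor <;> intro h <;> linarith

theorem le_neg_P_d_d_iff (hg : g.Pos) : P ≤ -P_d_d g ↔ 2 * relayMax g P ≤ linkTotal g P := by
  have := hg.r1
  rw [← mul_le_mul_iff_left₀ hg.r1, P_d_d, linkTotal, relayMax, neg_mul, sub_mul,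
    inv_mul_cancel₀ hg.r1.ne', div_eq_inv_mul]
  constructor <;> intro h <;> linarith

theorem le_P_r_d_iff (hg : g.Pos) : P ≤ P_r_d γ g ↔ relayMax g P ≤ γ := by
  have := hg.r1
  rw [← mul_le_mul_iff_left₀ hg.r1, P_r_d, relayMax, mul_assoc, inv_mul_cancel₀ hg.r1.ne']
  constructor <;> intro h <;> linarith

theorem le_P_rd_d_iff (hg : g.Pos) : P ≤ P_rd_d γ g ↔ linkTotal g P ≤ 2 * γ := by
  have := hg.r1
  rw [← mul_le_mul_iff_left₀ hg.r1, P_rd_d, linkTotal, sub_mul, mul_assoc,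
    inv_mul_cancel₀ hg.r1.ne', div_eq_inv_mul]
  constructor <;> intro h <;> linarith

theorem P_r_r_lt_iff (hg : g.Pos) (hγ : 0 < γ) (hP : 0 < P) :
    P_r_r γ g < P ↔ γ < relayMax g P * relayMax g.swap P :=
  posRoot_mul_lt_iff le_rfl le_rfl hg.r1 hg.r2 hγ hP

theorem P_r_rd_lt_iff (hg : g.Pos) (hγ : 0 < γ) (hP : 0 < P) :
    P_r_rd γ g < P ↔ 2 * γ < linkTotal g.swap P * relayMax g P := by
  have := div_pos hg.r2 hg.d2
  simp only [P_r_rd, ← div_eq_mul_inv]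
  exact posRoot_mul_lt_iff (by linarith) le_rfl hg.r2 hg.r1 (by linarith) hP

theorem P_rd_rd_lt_iff (hg : g.Pos) (hγ : 0 < γ) (hP : 0 < P) :
    P_rd_rd γ g < P ↔ 4 * γ < linkTotal g P * linkTotal g.swap P := by
  have := div_pos hg.r2 hg.d2
  have := div_pos hg.r1 hg.d1
  simp only [P_rd_rd, ← div_eq_mul_inv]
  exact posRoot_mul_lt_iff (by linarith) (by linarith) hg.r1 hg.r2 (by linarith) hP

theorem Pbar_r_rd_lt_iff (hg : g.Pos) (hγ : 0 < γ) (hP : 0 < P) :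
    Pbar_r_rd γ g < P ↔ γ * linkTotal g P < linkTotal g.swap P * relayMax g P ^ 2 :=
  posRoot_ratio_lt_iff (div_pos hg.r1 hg.d1) (div_pos hg.r2 hg.d2) hg.r1 hg.r2 hγ hP

theorem one_lt_relayMax (hg : g.Pos) (hP : 0 < P) : 1 < relayMax g P :=
  lt_add_of_pos_right _ (mul_pos hP hg.r1)

theorem relayMax_lt_linkTotal (hg : g.Pos) : relayMax g P < linkTotal g P := by
  have := div_pos hg.r1 hg.d1
  unfold relayMax linkTotal
  linarith

theorem not_RS1_iff (hg : g.Pos) (hγ : 1 < γ) : ¬ RS1 γ g ↔ R1 γ g ∨ R2 γ g ∨ RS2 γ g := by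
  have h1 := mul_lt_mul_of_pos_right hγ hg.r1
  have h2 := mul_lt_mul_of_pos_right hγ hg.r2
  unfold RS1 R1 R2 RS2
  constructor
  · intro h
    rw [not_le] at h
    rcases le_or_gt g.r2 g.r1 with h3 | h3
    · exact Or.inl ⟨h, h3⟩
    · rcases le_or_gt (γ * g.r1) g.r2 with h4 | h4
      · exact Or.inr (Or.inr h4)
      · exact Or.inr (Or.inl ⟨h4, h3⟩)
  · rintro (h | h | h) <;> rw [not_le] <;> linarith

theorem not_RS2_iff (hg : g.Pos) (hγ : 1 < γ) : ¬ RS2 γ g ↔ R1 γ g ∨ R2 γ g ∨ RS1 γ g := by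
  have h1 := mul_lt_mul_of_pos_right hγ hg.r1
  have h2 := mul_lt_mul_of_pos_right hγ hg.r2
  unfold RS1 R1 R2 RS2
  constructor
  · intro h
    rw [not_le] at h
    rcases le_or_gt g.r2 g.r1 with h3 | h3
    · rcases le_or_gt (γ * g.r2) g.r1 with h4 | h4
      · exact Or.inr (Or.inr h4)
      · exact Or.inl ⟨h4, h3⟩
    · exact Or.inr (Or.inl ⟨h, h3⟩)
  · rintro (h | h | h) <;> rw [not_le] <;> linarith

theorem R1_or_R2_iff (hg : g.Pos) (hγ : 1 < γ) : R1 γ g ∨ R2 γ g ↔ ¬ RS1 γ g ∧ ¬ RS2 γ g := by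
  have h1 := not_RS1_iff hg hγ
  have h2 : RS1 γ g → ¬ RS2 γ g := fun h => (not_RS2_iff hg hγ).2 (Or.inr (Or.inr h))
  have h3 := not_RS2_iff hg hγ
  tauto

end Thresholds

/-- For a positive budget the regimes are those of the normalized coordinates. -/
theorem LGR.holds_iff_normal {γ P : ℝ} {g : LinkGains} (hg : g.Pos) (hγ : 1 < γ) (hP : 0 < P)
    (l : LGR) : l.Holds γ g P ↔ l.Normal γ (relayMax g P) (linkTotal g P)
      (relayMax g.swap P) (linkTotal g.swap P)
      (OnlySourceOne γ g P) (OnlySourceOne γ g.swap P) := by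
  have hγ0 : 0 < γ := by linarith
  have hs := hg.swap
  -- thresholds of source 2 are thresholds of source 1 with the sources interchanged
  have a1 := le_P_d_d_iff (P := P) hg
  have a2 : P ≤ Phat_d_d g ↔ _ := le_P_d_d_iff (P := P) hs
  have b1 := le_neg_P_d_d_iff (P := P) hg
  have b2 : P ≤ -Phat_d_d g ↔ _ := le_neg_P_d_d_iff (P := P) hs
  have c1 := le_P_r_d_iff (γ := γ) (P := P) hg
  have c2 : P ≤ P_d_r γ g ↔ _ := le_P_r_d_iff (γ := γ) (P := P) hs
  have e1 := le_P_rd_d_iff (γ := γ) (P := P) hg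
  have e2 : P ≤ P_d_rd γ g ↔ _ := le_P_rd_d_iff (γ := γ) (P := P) hs
  have f := P_r_r_lt_iff hg hγ0 hP
  have i1 := P_r_rd_lt_iff hg hγ0 hP
  have i2 : P_rd_r γ g < P ↔ 2 * γ < linkTotal g P * relayMax g.swap P := P_r_rd_lt_iff hs hγ0 hP
  have j := P_rd_rd_lt_iff hg hγ0 hP
  have k1 := Pbar_r_rd_lt_iff hg hγ0 hP
  have k2 : Pbar_rd_r γ g < P ↔ γ * linkTotal g.swap P < linkTotal g P * relayMax g.swap P ^ 2 :=
    Pbar_r_rd_lt_iff hs hγ0 hP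
  have n1 := not_RS1_iff hg hγ
  have n2 := not_RS2_iff hg hγ
  have n3 := R1_or_R2_iff hg hγ
  have o2 : OnlySourceOne γ g.swap P ↔ (RS2 γ g ∧ Pbar_d_rd γ g < (P : EReal)) ∨
      (¬ RS2 γ g ∧ (P : EReal) ≤ Pbar_d_rd γ g) := Iff.rfl
  have a1' := not_congr a1
  have a2' := not_congr a2
  have b1' := not_congr b1
  have b2' := not_congr b2
  have c1' := not_congr c1
  have c2' := not_congr c2
  have e1' := not_congr e1
  have e2' := not_congr e2
  have f' := not_congr f
  have i1' := not_congr i1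
  have i2' := not_congr i2
  have j' := not_congr j
  have k1' := not_congr k1
  have k2' := not_congr k2
  rw [not_le, not_le] at a1' a2' b1' b2' c1' c2' e1' e2'
  rw [not_lt, not_lt] at f' i1' i2' j' k1' k2'
  cases l <;> simp only [Holds, Normal, le_min_iff, max_lt_iff, ← n1, ← n2, n3,
    a1, a2, b1, b2, c1, c2, e1, e2, f, i1, i2, j, k1, k2, a1', a2', b1', b2', c1', c2', e1', e2',
    f', i1', i2', j', k1', k2', hP.le, true_and, and_assoc]
  case S_rd_d =>
    unfold OnlySourceOne
    by_cases h : RS1 γ g <;> simp [h]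
  case S_d_rd =>
    rw [o2]
    by_cases h : RS2 γ g <;> simp [h]
  case S_rd_rd =>
    have h12 : RS1 γ g → ¬ RS2 γ g := fun h => n2.2 (Or.inr (Or.inr h))
    rw [o2, OnlySourceOne]
    by_cases h : RS1 γ g
    · simp [h, h12 h, and_comm]
    · by_cases h' : RS2 γ g <;> simp [h, h']

/-! ### Exactly one regime holds -/

/-- The maximizer of `u * (T - u)` over `1 ≤ u ≤ U`, for `1 ≤ U`. -/
noncomputable def waterLevel (U T : ℝ) : ℝ := max 1 (min U (T / 2))

section Normal

variable {γ U T U₁ T₁ U₂ T₂ : ℝ} {D₁ D₂ : Prop}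

theorem one_le_waterLevel : 1 ≤ waterLevel U T := le_max_left _ _

theorem waterLevel_of_le_two (h : T ≤ 2) : waterLevel U T = 1 :=
  max_eq_left ((min_le_right _ _).trans (by linarith))

theorem waterLevel_of_two_mul_le (hU : 1 ≤ U) (h : 2 * U ≤ T) : waterLevel U T = U := by
  rw [waterLevel, min_eq_left (by linarith), max_eq_right hU]

theorem waterLevel_of_mem (h1 : 2 < T) (h2 : T < 2 * U) : waterLevel U T = T / 2 := by
  rw [waterLevel, min_eq_right (by linarith), max_eq_right (by linarith)]

theorem waterLevel_cases (hU : 1 ≤ U) (T : ℝ) :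
    (T ≤ 2 ∧ waterLevel U T = 1) ∨ (2 < T ∧ T < 2 * U ∧ waterLevel U T = T / 2) ∨
      (2 * U ≤ T ∧ waterLevel U T = U) := by
  rcases le_or_gt T 2 with h | h
  · exact Or.inl ⟨h, waterLevel_of_le_two h⟩
  rcases lt_or_ge T (2 * U) with h' | h'
  · exact Or.inr (Or.inl ⟨h, h', waterLevel_of_mem h h'⟩)
  · exact Or.inr (Or.inr ⟨h', waterLevel_of_two_mul_le hU h'⟩)

theorem waterLevel_le (hU : 1 ≤ U) : waterLevel U T ≤ U := max_le hU (min_le_left _ _)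

theorem lt_waterLevel {c : ℝ} (h1 : c < U) (h2 : 2 * c < T) : c < waterLevel U T :=
  lt_max_of_lt_right (lt_min h1 (by linarith))

/-- A regime `A` forces the waterfilling solution to satisfy the relay constraint. -/
theorem LGR.Normal.waterLevel_mul_le (hγ : 1 < γ) (hU₁ : 1 ≤ U₁) (hU₂ : 1 ≤ U₂) {l : LGR}
    (h : l.Normal γ U₁ T₁ U₂ T₂ D₁ D₂) (hl : ¬ l.IsSaturation) :
    waterLevel U₁ T₁ * waterLevel U₂ T₂ ≤ γ := by
  cases l <;> simp only [IsSaturation, not_true_eq_false, not_false_eq_true] at hl <;>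
    simp only [Normal] at h
  case A_d_d => rw [waterLevel_of_le_two h.1, waterLevel_of_le_two h.2]; linarith
  case A_d_r =>
    rw [waterLevel_of_le_two h.2.1, waterLevel_of_two_mul_le hU₂ h.1]; linarith
  case A_r_d =>
    rw [waterLevel_of_le_two h.2.1, waterLevel_of_two_mul_le hU₁ h.1]; linarith
  case A_r_r =>
    rw [waterLevel_of_two_mul_le hU₁ h.1, waterLevel_of_two_mul_le hU₂ h.2.1]; exact h.2.2
  case A_rd_d =>
    rw [waterLevel_of_mem h.1 h.2.1, waterLevel_of_le_two h.2.2.1]; linarith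
  case A_d_rd =>
    rw [waterLevel_of_mem h.1 h.2.1, waterLevel_of_le_two h.2.2.1]; linarith
  case A_r_rd =>
    rw [waterLevel_of_mem h.1 h.2.1, waterLevel_of_two_mul_le hU₁ h.2.2.1]; linarith
  case A_rd_r =>
    rw [waterLevel_of_mem h.1 h.2.1, waterLevel_of_two_mul_le hU₂ h.2.2.1]; linarith
  case A_rd_rd =>
    rw [waterLevel_of_mem h.1 h.2.2.1, waterLevel_of_mem h.2.1 h.2.2.2.1]; linarith

theorem exists_normal_of_waterLevel_mul_le (hU₁ : 1 ≤ U₁) (hU₂ : 1 ≤ U₂)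
    (h : waterLevel U₁ T₁ * waterLevel U₂ T₂ ≤ γ) :
    ∃ l : LGR, l.Normal γ U₁ T₁ U₂ T₂ D₁ D₂ := by
  rcases waterLevel_cases hU₁ T₁ with ⟨a, e⟩ | ⟨a, a', e⟩ | ⟨a, e⟩ <;>
    rcases waterLevel_cases hU₂ T₂ with ⟨b, f⟩ | ⟨b, b', f⟩ | ⟨b, f⟩ <;> rw [e, f] at h
  · exact ⟨.A_d_d, a, b⟩
  · exact ⟨.A_d_rd, b, b', a, by linarith⟩
  · exact ⟨.A_d_r, b, a, by linarith⟩
  · exact ⟨.A_rd_d, a, a', b, by linarith⟩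
  · exact ⟨.A_rd_rd, a, b, a', b', by linarith⟩
  · exact ⟨.A_rd_r, a, a', b, by linarith⟩
  · exact ⟨.A_r_d, a, b, by linarith⟩
  · exact ⟨.A_r_rd, b, b', a, by linarith⟩
  · exact ⟨.A_r_r, a, b, h⟩

/-- In `S_r_rd` source 1 would use its relay link only, even without the relay constraint. -/
theorem two_mul_le_of_S_r_rd (hγ : 0 < γ) (hU₁ : 1 ≤ U₁) (h1 : 2 * γ < T₂ * U₁)
    (h2 : T₂ * U₁ ^ 2 ≤ γ * T₁) : 2 * U₁ ≤ T₁ := by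
  have := mul_lt_mul_of_pos_right h1 (by linarith : 0 < U₁)
  refine le_of_mul_le_mul_left ?_ hγ
  linarith

theorem lt_waterLevel_mul_of_S_r_rd (hγ : 0 < γ) (hU₁ : 1 ≤ U₁) (h0 : γ < U₁ * U₂)
    (h1 : 2 * γ < T₂ * U₁) (h2 : T₂ * U₁ ^ 2 ≤ γ * T₁) :
    γ < waterLevel U₁ T₁ * waterLevel U₂ T₂ := by
  have hU : 0 < U₁ := by linarith
  rw [waterLevel_of_two_mul_le hU₁ (two_mul_le_of_S_r_rd hγ hU₁ h1 h2), mul_comm, ← div_lt_iff₀ hU]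
  refine lt_waterLevel ?_ ?_
  · rw [div_lt_iff₀ hU]; linarith
  · rw [← mul_div_assoc, div_lt_iff₀ hU]; exact h1

/-- A regime `S` forces the waterfilling solution to violate the relay constraint. -/
theorem LGR.Normal.lt_waterLevel_mul (hγ : 1 < γ) (hU₁ : 1 < U₁) (hT₁ : U₁ < T₁) (hU₂ : 1 < U₂)
    (hT₂ : U₂ < T₂) {l : LGR} (h : l.Normal γ U₁ T₁ U₂ T₂ D₁ D₂) (hl : l.IsSaturation) :
    γ < waterLevel U₁ T₁ * waterLevel U₂ T₂ := by
  have hγ0 : 0 < γ := by linarith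
  cases l <;> simp only [IsSaturation] at hl <;> simp only [Normal] at h
  case S_r_rd => exact lt_waterLevel_mul_of_S_r_rd hγ0 hU₁.le h.1 h.2.1 h.2.2.1
  case S_rd_r =>
    rw [mul_comm]
    exact lt_waterLevel_mul_of_S_r_rd hγ0 hU₂.le (by linarith [h.1]) h.2.1 h.2.2.1
  case S_rd_d =>
    exact (lt_waterLevel h.1 h.2.1).trans_le
      (le_mul_of_one_le_right (by linarith [one_le_waterLevel (U := U₁) (T := T₁)])
        one_le_waterLevel)
  case S_d_rd =>
    exact (lt_waterLevel h.1 h.2.1).trans_le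
      (le_mul_of_one_le_left (by linarith [one_le_waterLevel (U := U₂) (T := T₂)])
        one_le_waterLevel)
  case S_rd_rd =>
    obtain ⟨h1, h2, h3, -, -⟩ := h
    have l1 : min U₁ (T₁ / 2) ≤ waterLevel U₁ T₁ := le_max_right _ _
    have l2 : min U₂ (T₂ / 2) ≤ waterLevel U₂ T₂ := le_max_right _ _
    have p1 : 0 ≤ min U₂ (T₂ / 2) := le_min (by linarith) (by linarith)
    refine lt_of_lt_of_le ?_ (mul_le_mul l1 l2 p1 (zero_le_one.trans one_le_waterLevel))
    have t1 : 0 < T₁ := by linarith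
    have t2 : 0 < T₂ := by linarith
    rcases min_cases U₁ (T₁ / 2) with ⟨e1, h4⟩ | ⟨e1, -⟩ <;>
      rcases min_cases U₂ (T₂ / 2) with ⟨e2, h5⟩ | ⟨e2, -⟩ <;> rw [e1, e2]
    · have hm := mul_lt_mul'' h1 h2 (by positivity) (by positivity)
      have hm' : γ ^ 2 * (T₁ * T₂) < (U₁ * U₂) ^ 2 * (T₁ * T₂) := by linarith
      exact lt_of_pow_lt_pow_left₀ 2 (by positivity) (lt_of_mul_lt_mul_right hm' (by positivity))
    · have hm := mul_le_mul_of_nonneg_left h4 hγ0.le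
      refine lt_of_mul_lt_mul_right (a := 2 * U₁) ?_ (by linarith)
      linarith
    · have hm := mul_le_mul_of_nonneg_left h5 hγ0.le
      refine lt_of_mul_lt_mul_right (a := 2 * U₂) ?_ (by linarith)
      linarith
    · linarith

/-- If the minimizer of `T₁ u₂ + T₂ u₁` on the hyperbola `u₁ u₂ = γ` lies at or beyond the end of
the arc where `u₁` is largest, then `S_rd_d` (that end is `u₁ = γ`) or `S_r_rd` (it is `u₁ = U₁`)
holds. -/
theorem exists_normal_of_mul_le (hγ : 1 < γ) (hU₁ : 1 < U₁) (hU₂ : 1 < U₂) (hT₂ : U₂ < T₂)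
    (hD : D₁ ∨ U₁ ≤ γ ∧ T₂ * U₁ ^ 2 ≤ γ * T₁) (hDle : D₁ → γ * T₂ ≤ T₁)
    (h : γ < waterLevel U₁ T₁ * waterLevel U₂ T₂) :
    (γ < U₁ ∧ 2 * γ < T₁ ∧ D₁) ∨
      (γ < U₁ * U₂ ∧ 2 * γ < T₂ * U₁ ∧ T₂ * U₁ ^ 2 ≤ γ * T₁ ∧ U₁ ≤ γ) := by
  have hw₁ := waterLevel_le (T := T₁) hU₁.le
  have hw₂ := waterLevel_le (T := T₂) hU₂.le
  have ho₂ : 1 ≤ waterLevel U₂ T₂ := one_le_waterLevel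
  have ho₁ : 1 ≤ waterLevel U₁ T₁ := one_le_waterLevel
  rcases le_or_gt U₁ γ with hU | hU
  · have hle : T₂ * U₁ ^ 2 ≤ γ * T₁ := by
      rcases hD with hD | hD
      · have h2 : U₁ ^ 2 ≤ γ ^ 2 := pow_le_pow_left₀ (by linarith) hU 2
        have h3 := mul_le_mul_of_nonneg_left h2 (by linarith : 0 ≤ T₂)
        have h4 := mul_le_mul_of_nonneg_left (hDle hD) (by linarith : 0 ≤ γ)
        linarith
      · exact hD.2
    refine Or.inr ⟨h.trans_le (mul_le_mul hw₁ hw₂ (by linarith) (by linarith)), ?_, hle, hU⟩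
    by_contra! h4
    have h5 : waterLevel U₁ T₁ * waterLevel U₂ T₂ ≤ U₁ * waterLevel U₂ T₂ :=
      mul_le_mul_of_nonneg_right hw₁ (by linarith)
    have h6 : U₁ * waterLevel U₂ T₂ ≤ γ := by
      rcases waterLevel_cases hU₂.le T₂ with ⟨-, e⟩ | ⟨-, -, e⟩ | ⟨h7, e⟩ <;> rw [e]
      · linarith
      · linarith
      · have := mul_le_mul_of_nonneg_right h7 (by linarith : 0 ≤ U₁)
        linarith
    linarith
  · have hD1 : D₁ := hD.resolve_right fun h => absurd h.1 (not_le.2 hU)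
    refine Or.inl ⟨hU, ?_, hD1⟩
    by_contra! h4
    have hT : T₂ ≤ 2 := by
      refine le_of_mul_le_mul_left ?_ (by linarith : 0 < γ)
      linarith [hDle hD1]
    rw [waterLevel_of_le_two hT, mul_one] at h
    have : waterLevel U₁ T₁ ≤ γ := max_le hγ.le ((min_le_right _ _).trans (by linarith))
    linarith

/-- For comparable totals, waterfilling can exceed `γ` only if the unconstrained levels `T₁ / 2`,
`T₂ / 2` do: a source held at level `1` would force `T₂ ≤ 2 γ` or `T₁ ≤ 2 γ` on the other one. -/
theorem four_mul_lt_of_lt_waterLevel_mul (hU₁ : 1 ≤ U₁) (hU₂ : 1 ≤ U₂)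
    (hT₁ : U₁ < T₁) (hT₂ : U₂ < T₂) (h1 : T₁ ≤ γ * T₂) (h2 : T₂ ≤ γ * T₁)
    (h : γ < waterLevel U₁ T₁ * waterLevel U₂ T₂) : 4 * γ < T₁ * T₂ := by
  have w₁ : waterLevel U₁ T₁ ≤ max 1 (T₁ / 2) := max_le_max_left _ (min_le_right _ _)
  have w₂ : waterLevel U₂ T₂ ≤ max 1 (T₂ / 2) := max_le_max_left _ (min_le_right _ _)
  have o₂ : 1 ≤ waterLevel U₂ T₂ := one_le_waterLevel
  have hw := h.trans_le (mul_le_mul w₁ w₂ (by linarith) (zero_le_one.trans (le_max_left _ _)))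
  rcases max_cases 1 (T₁ / 2) with ⟨e1, h3⟩ | ⟨e1, h3⟩ <;>
    rcases max_cases 1 (T₂ / 2) with ⟨e2, h4⟩ | ⟨e2, h4⟩ <;> rw [e1, e2] at hw
  · have : γ * T₁ < 1 * T₁ := mul_lt_mul_of_pos_right (by linarith) (by linarith)
    have : γ * T₂ < 1 * T₂ := mul_lt_mul_of_pos_right (by linarith) (by linarith)
    linarith
  · have hγ : 0 < γ := by
      by_contra! hγ
      linarith [mul_nonneg_of_nonpos_of_nonpos hγ (by linarith : -T₁ ≤ 0)]
    have := mul_le_mul_of_nonneg_left (by linarith : T₁ ≤ 2) hγ.le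
    linarith
  · have hγ : 0 < γ := by
      by_contra! hγ
      linarith [mul_nonneg_of_nonpos_of_nonpos hγ (by linarith : -T₂ ≤ 0)]
    have := mul_le_mul_of_nonneg_left (by linarith : T₂ ≤ 2) hγ.le
    linarith
  · linarith

/-- A regime `A` holds exactly when waterfilling respects the relay constraint. Otherwise the optimum
lies on the arc of `u₁ u₂ = γ` inside the box, and the regimes `S` list its position there: either
end, each of which is cut off by one of two sides of the box, or the interior. `D₁`, `D₂` need only
be known up to the ties `γ T₂ = T₁`, `γ T₁ = T₂`, where neighbouring regimes agree. -/
theorem LGR.existsUnique_normal (hγ : 1 < γ) (hU₁ : 1 < U₁) (hT₁ : U₁ < T₁) (hU₂ : 1 < U₂)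
    (hT₂ : U₂ < T₂) (hD₁ : D₁ → γ * T₂ ≤ T₁) (hD₁' : γ * T₂ < T₁ → D₁)
    (hD₂ : D₂ → γ * T₁ ≤ T₂) (hD₂' : γ * T₁ < T₂ → D₂) :
    ∃! l : LGR, l.Normal γ U₁ T₁ U₂ T₂ D₁ D₂ := by
  have hγ0 : 0 < γ := by linarith
  have t₁ : T₁ < γ * T₁ := by
    have := mul_lt_mul_of_pos_right hγ (by linarith : 0 < T₁); linarith
  have t₂ : T₂ < γ * T₂ := by
    have := mul_lt_mul_of_pos_right hγ (by linarith : 0 < T₂); linarith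
  refine existsUnique_of_exists_of_unique ?_ ?_
  · rcases le_or_gt (waterLevel U₁ T₁ * waterLevel U₂ T₂) γ with h | h
    · exact exists_normal_of_waterLevel_mul_le hU₁.le hU₂.le h
    by_cases c1 : D₁ ∨ U₁ ≤ γ ∧ T₂ * U₁ ^ 2 ≤ γ * T₁
    · rcases exists_normal_of_mul_le hγ hU₁ hU₂ hT₂ c1 hD₁ h with h | h
      · exact ⟨.S_rd_d, h⟩
      · exact ⟨.S_r_rd, h⟩
    by_cases c2 : D₂ ∨ U₂ ≤ γ ∧ T₁ * U₂ ^ 2 ≤ γ * T₂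
    · rw [mul_comm] at h
      rcases exists_normal_of_mul_le hγ hU₂ hU₁ hT₁ c2 hD₂ h with h | h
      · exact ⟨.S_d_rd, h⟩
      · exact ⟨.S_rd_r, by rw [mul_comm]; exact h.1, h.2⟩
    · obtain ⟨d1, c1⟩ := not_or.1 c1
      obtain ⟨d2, c2⟩ := not_or.1 c2
      have e1 : T₁ ≤ γ * T₂ := not_lt.1 (mt hD₁' d1)
      have e2 : T₂ ≤ γ * T₁ := not_lt.1 (mt hD₂' d2)
      -- for `γ < U` the quadratic condition of `S_rd_rd` follows from `T' ≤ γ T`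
      have key : ∀ {U T T' : ℝ}, 0 < T → T' ≤ γ * T → ¬ (U ≤ γ ∧ T * U ^ 2 ≤ γ * T') →
          γ * T' < T * U ^ 2 := by
        intro U T T' hT hTT hn
        rcases le_or_gt U γ with hU | hU
        · exact not_le.1 fun h => hn ⟨hU, h⟩
        · have h2 : γ ^ 2 < U ^ 2 := pow_lt_pow_left₀ hU hγ0.le two_ne_zero
          have h3 := mul_lt_mul_of_pos_left h2 hT
          have h4 := mul_le_mul_of_nonneg_left hTT hγ0.le
          linarith
      exact ⟨.S_rd_rd, key (by linarith) e2 c2, key (by linarith) e1 c1,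
        four_mul_lt_of_lt_waterLevel_mul hU₁.le hU₂.le hT₁ hT₂ e1 e2 h, d1, d2⟩
  · intro l l' h h'
    have hA := fun s => h.waterLevel_mul_le hγ hU₁.le hU₂.le s
    have hS := fun s => h.lt_waterLevel_mul hγ hU₁ hT₁ hU₂ hT₂ s
    have hA' := fun s => h'.waterLevel_mul_le hγ hU₁.le hU₂.le s
    have hS' := fun s => h'.lt_waterLevel_mul hγ hU₁ hT₁ hU₂ hT₂ s
    by_cases s : l.IsSaturation <;> by_cases s' : l'.IsSaturation
    · clear hA hS hA' hS'
      have x12 : T₂ * U₁ ^ 2 ≤ γ * T₁ → T₁ * U₂ ^ 2 ≤ γ * T₂ → γ < U₁ * U₂ → False := by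
        intro a b c
        have t1 : 0 < T₁ := by linarith
        have t2 : 0 < T₂ := by linarith
        have hm := mul_le_mul a b (by positivity) (by positivity)
        have hm' : (U₁ * U₂) ^ 2 * (T₁ * T₂) ≤ γ ^ 2 * (T₁ * T₂) := by linarith
        have := le_of_pow_le_pow_left₀ two_ne_zero hγ0.le (le_of_mul_le_mul_right hm' (by positivity))
        linarith
      have x14 : T₂ * U₁ ^ 2 ≤ γ * T₁ → D₂ → False := by
        intro a d
        have := mul_lt_mul_of_pos_left (one_lt_pow₀ hU₁ two_ne_zero) (by linarith : 0 < T₂)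
        linarith [hD₂ d]
      have x23 : T₁ * U₂ ^ 2 ≤ γ * T₂ → D₁ → False := by
        intro a d
        have := mul_lt_mul_of_pos_left (one_lt_pow₀ hU₂ two_ne_zero) (by linarith : 0 < T₁)
        linarith [hD₁ d]
      have x34 : D₁ → D₂ → False := by
        intro a b
        have := hD₁ a
        have := hD₂ b
        linarith
      cases l <;> simp only [IsSaturation] at s <;> cases l' <;>
        simp only [IsSaturation] at s' <;> simp only [Normal] at h h' <;>
        first
        | rfl
        | exact (x12 h.2.2.1 h'.2.2.1 h.1).elim
        | exact (x12 h'.2.2.1 h.2.2.1 h.1).elim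
        | exact (x14 h.2.2.1 h'.2.2).elim
        | exact (x14 h'.2.2.1 h.2.2).elim
        | exact (x23 h.2.2.1 h'.2.2).elim
        | exact (x23 h'.2.2.1 h.2.2).elim
        | exact (x34 h.2.2 h'.2.2).elim
        | exact (x34 h'.2.2 h.2.2).elim
        | exact (h.2.2.2.1 h'.2.2).elim
        | exact (h.2.2.2.2 h'.2.2).elim
        | exact (h'.2.2.2.1 h.2.2).elim
        | exact (h'.2.2.2.2 h.2.2).elim
        | (exfalso; linarith)
    · exact absurd (hS s) (not_lt.2 (hA' s'))
    · exact absurd (hS' s') (not_lt.2 (hA s))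
    · clear hA hS hA' hS' hD₁ hD₁' hD₂ hD₂'
      cases l <;> simp only [IsSaturation, not_true_eq_false] at s <;> cases l' <;>
        simp only [IsSaturation, not_true_eq_false] at s' <;> simp only [Normal] at h h' <;>
        first
        | rfl
        | (exfalso; linarith)

end Normal

/-! ### The allocations satisfy the Kuhn–Tucker conditions -/

section Stationary

variable {γ P t : ℝ} {g : LinkGains}

/-- In the coordinate `u = 1 + r₁ q` the derivative is proportional to `t (T - u) - u`. -/
theorem link_slope_eq (hg : g.Pos) (q : ℝ) :
    t * (g.r1 * (1 + g.d1 * (P - q))) - g.d1 * (1 + g.r1 * q) =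
      g.d1 * (t * (linkTotal g P - (1 + g.r1 * q)) - (1 + g.r1 * q)) := by
  have := hg.d1.ne'
  unfold linkTotal
  field_simp
  ring

theorem linkStationary_zero (hg : g.Pos) (hP : 0 ≤ P) (h : t * (linkTotal g P - 1) ≤ 1) :
    LinkStationary g.r1 g.d1 P t 0 := by
  refine .zero hP ?_
  have e := link_slope_eq (t := t) (P := P) hg 0
  simp only [mul_zero, add_zero, sub_zero, mul_one] at e
  have := mul_nonpos_of_nonneg_of_nonpos hg.d1.le (sub_nonpos.2 h)
  linarith

theorem linkStationary_full (hg : g.Pos) (hP : 0 ≤ P)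
    (h : relayMax g P ≤ t * (linkTotal g P - relayMax g P)) :
    LinkStationary g.r1 g.d1 P t P := by
  refine .full hP ?_
  have e := link_slope_eq (t := t) (P := P) hg P
  rw [sub_self, mul_zero, add_zero, mul_one] at e
  rw [relayMax, mul_comm P] at h
  have := mul_nonneg hg.d1.le (sub_nonneg.2 h)
  linarith

theorem linkStationary_interior (hg : g.Pos) {q u : ℝ} (hu : 1 + g.r1 * q = u) (h1 : 1 ≤ u)
    (hU : u ≤ relayMax g P) (h : t * (linkTotal g P - u) = u) :
    LinkStationary g.r1 g.d1 P t q := by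
  subst hu
  refine .interior ?_ ?_ ?_
  · exact nonneg_of_mul_nonneg_right (by linarith) hg.r1
  · rw [relayMax] at hU
    exact le_of_mul_le_mul_left (by linarith) hg.r1
  · rw [← sub_eq_zero, link_slope_eq hg, h, sub_self, mul_zero]

theorem wq_eq (hg : g.Pos) : 1 + g.r1 * wq1 g P = linkTotal g P / 2 := by
  have := hg.r1.ne'
  have := hg.d1.ne'
  unfold wq1 linkTotal
  field_simp
  ring

theorem linkStationary_water (hg : g.Pos) (h1 : 2 < linkTotal g P)
    (h2 : linkTotal g P < 2 * relayMax g P) : LinkStationary g.r1 g.d1 P 1 (wq1 g P) :=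
  linkStationary_interior hg (wq_eq hg) (by linarith) (by linarith) (by ring)

theorem linkStationary_water_zero (hg : g.Pos) (hP : 0 ≤ P) (h : linkTotal g P ≤ 2) :
    LinkStationary g.r1 g.d1 P 1 0 :=
  linkStationary_zero hg hP (by linarith)

theorem linkStationary_water_full (hg : g.Pos) (hP : 0 ≤ P)
    (h : 2 * relayMax g P ≤ linkTotal g P) : LinkStationary g.r1 g.d1 P 1 P :=
  linkStationary_full hg hP (by linarith)

/-- The multiplier of `S_r_rd` is determined by source 2, which splits its power. -/
theorem linkStationary_S_r_rd (hg : g.Pos) (hP : 0 < P) (h0 : γ < relayMax g P * relayMax g.swap P)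
    (h1 : 2 * γ < linkTotal g.swap P * relayMax g P)
    (h2 : linkTotal g.swap P * relayMax g P ^ 2 ≤ γ * linkTotal g P) (h3 : relayMax g P ≤ γ) :
    ∃ t, (0 ≤ t ∧ t ≤ 1) ∧ LinkStationary g.r1 g.d1 P t P ∧
      LinkStationary g.r2 g.d2 P t (g.r2⁻¹ * (γ / (1 + P * g.r1) - 1)) := by
  have hU : 0 < relayMax g P := by linarith [one_lt_relayMax hg hP]
  have hγ : 0 < γ := by linarith
  have hu : 2 * (γ / relayMax g P) < linkTotal g.swap P := by
    rwa [← mul_div_assoc, div_lt_iff₀ hU]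
  have hu0 : 0 < γ / relayMax g P := div_pos hγ hU
  have hden : 0 < linkTotal g.swap P - γ / relayMax g P := by linarith
  refine ⟨γ / relayMax g P / (linkTotal g.swap P - γ / relayMax g P),
    ⟨(div_pos hu0 hden).le, (div_le_one hden).2 (by linarith)⟩, ?_, ?_⟩
  · refine linkStationary_full hg hP.le ?_
    rw [div_mul_eq_mul_div, le_div_iff₀ hden]
    have e : γ / relayMax g P * relayMax g P = γ := div_mul_cancel₀ _ hU.ne'
    have h4 : linkTotal g.swap P * relayMax g P ≤ γ / relayMax g P * linkTotal g P := by
      rw [div_mul_eq_mul_div, le_div_iff₀ hU]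
      linarith
    linarith
  · refine linkStationary_interior hg.swap (u := γ / relayMax g P) ?_ ?_ ?_ ?_
    · have := hg.r2.ne'
      simp only [LinkGains.swap, relayMax]
      field_simp
      ring
    · rwa [le_div_iff₀ hU, one_mul]
    · rw [div_le_iff₀ hU]; linarith
    · exact div_mul_cancel₀ _ hden.ne'

/-- The multiplier of `S_rd_d` is determined by source 1, which splits its power. -/
theorem linkStationary_S_rd_d (hg : g.Pos) (hP : 0 < P) (hγ : 1 < γ) (h0 : γ < relayMax g P)
    (h1 : 2 * γ < linkTotal g P) (h2 : γ * linkTotal g.swap P ≤ linkTotal g P) :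
    ∃ t, (0 ≤ t ∧ t ≤ 1) ∧ LinkStationary g.r1 g.d1 P t ((γ - 1) * g.r1⁻¹) ∧
      LinkStationary g.r2 g.d2 P t 0 := by
  have hden : 0 < linkTotal g P - γ := by linarith
  refine ⟨γ / (linkTotal g P - γ), ⟨(div_pos (by linarith) hden).le,
    (div_le_one hden).2 (by linarith)⟩, ?_, ?_⟩
  · refine linkStationary_interior hg (u := γ) ?_ hγ.le h0.le (div_mul_cancel₀ _ hden.ne')
    have := hg.r1.ne'
    field_simp
    ring
  · refine linkStationary_zero hg.swap hP.le ?_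
    rw [div_mul_eq_mul_div, div_le_one hden]
    linarith

theorem sqrt_mul_div_eq {a b c : ℝ} (ha : 0 < a) (hb : 0 < b) :
    √(c * (a / b)) = a * √(c / (a * b)) := by
  rw [show c * (a / b) = a ^ 2 * (c / (a * b)) by field_simp, Real.sqrt_mul (sq_nonneg a),
    Real.sqrt_sq ha.le]

theorem sq_eq (hg : g.Pos) :
    1 + g.r1 * sq1 γ g P = √(γ * (linkTotal g P / linkTotal g.swap P)) := by
  have e1 : P * g.r1 + g.r1 * g.d1⁻¹ + 1 = linkTotal g P := by rw [linkTotal]; ring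
  have e2 : P * g.r2 + g.r2 * g.d2⁻¹ + 1 = linkTotal g.swap P := by
    rw [linkTotal, LinkGains.swap]; ring
  have := hg.r1.ne'
  rw [sq1, e1, e2]
  field_simp
  ring

theorem linkTotal_pos (hg : g.Pos) (hP : 0 < P) : 0 < linkTotal g P := by
  linarith [one_lt_relayMax hg hP, relayMax_lt_linkTotal (P := P) hg]

theorem linkStationary_S_rd_rd (hg : g.Pos) (hP : 0 < P) {m : ℝ}
    (hm : m = √(γ / (linkTotal g P * linkTotal g.swap P))) (hm1 : m < 1)
    (h1 : linkTotal g.swap P ≤ γ * linkTotal g P)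
    (h2 : γ * linkTotal g P < linkTotal g.swap P * relayMax g P ^ 2) :
    LinkStationary g.r1 g.d1 P (m / (1 - m)) (sq1 γ g P) := by
  have t1 := linkTotal_pos hg hP
  have t2 := linkTotal_pos hg.swap hP
  refine linkStationary_interior hg (sq_eq hg) ?_ ?_ ?_
  · rw [Real.one_le_sqrt, ← mul_div_assoc, le_div_iff₀ t2, one_mul]
    exact h1
  · rw [Real.sqrt_le_iff, ← mul_div_assoc, div_le_iff₀ t2]
    exact ⟨by linarith [one_lt_relayMax hg hP], by linarith⟩
  · rw [sqrt_mul_div_eq t1 t2, ← hm]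
    have : 1 - m ≠ 0 := by linarith
    field_simp

theorem alloc_p1 (l : LGR) : (l.alloc γ g P).p1 = P - (l.alloc γ g P).q1 := by
  cases l <;> simp [LGR.alloc, wp1, wq1] <;> ring

theorem alloc_p2 (l : LGR) : (l.alloc γ g P).p2 = P - (l.alloc γ g P).q2 := by
  cases l <;> simp [LGR.alloc, wp2, wq2] <;> ring

/-- The data from which the optimality of the allocation of a regime follows: multiplier `1` in the
regimes `A`, an active relay constraint in the regimes `S`. -/
def RegimeStationary (γ : ℝ) (g : LinkGains) (P : ℝ) (l : LGR) : Prop :=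
  ∃ t, LinkStationary g.r1 g.d1 P t (l.alloc γ g P).q1 ∧
    LinkStationary g.r2 g.d2 P t (l.alloc γ g P).q2 ∧
    (¬ l.IsSaturation → t = 1 ∧ relayProduct g (l.alloc γ g P) ≤ γ) ∧
    (l.IsSaturation → (0 ≤ t ∧ t ≤ 1) ∧ relayProduct g (l.alloc γ g P) = γ)

theorem LGR.Normal.regimeStationary (hg : g.Pos) (hγ : 1 < γ) (hP : 0 < P) {l : LGR}
    (h : l.Normal γ (relayMax g P) (linkTotal g P) (relayMax g.swap P) (linkTotal g.swap P)
      (OnlySourceOne γ g P) (OnlySourceOne γ g.swap P)) :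
    RegimeStationary γ g P l := by
  have hs := hg.swap
  have hP0 := hP.le
  have eU1 : 1 + g.r1 * P = relayMax g P := by rw [relayMax, mul_comm]
  have eU2 : 1 + g.r2 * P = relayMax g.swap P := by rw [relayMax, mul_comm]; rfl
  have eT1 : 1 + g.r1 * wq1 g P = linkTotal g P / 2 := wq_eq hg
  have eT2 : 1 + g.r2 * wq2 g P = linkTotal g.swap P / 2 := wq_eq hs
  have U1 := one_lt_relayMax hg hP
  have U2 := one_lt_relayMax hs hP
  have r1 := hg.r1.ne'
  have r2 := hg.r2.ne'
  unfold RegimeStationary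
  cases l <;> simp only [Normal] at h <;>
    simp only [alloc, IsSaturation, relayProduct, not_true_eq_false, not_false_eq_true,
      false_imp_iff, true_imp_iff, and_true, true_and, mul_zero, add_zero, mul_one, one_mul,
      eU1, eU2, eT1, eT2]
  case A_d_d =>
    exact ⟨1, linkStationary_water_zero hg hP0 h.1, linkStationary_water_zero hs hP0 h.2,
      rfl, hγ.le⟩
  case A_d_r =>
    exact ⟨1, linkStationary_water_zero hg hP0 h.2.1, linkStationary_water_full hs hP0 h.1,
      rfl, h.2.2⟩
  case A_r_d =>
    exact ⟨1, linkStationary_water_full hg hP0 h.1, linkStationary_water_zero hs hP0 h.2.1,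
      rfl, h.2.2⟩
  case A_r_r =>
    exact ⟨1, linkStationary_water_full hg hP0 h.1, linkStationary_water_full hs hP0 h.2.1,
      rfl, h.2.2⟩
  case A_rd_d =>
    exact ⟨1, linkStationary_water hg h.1 h.2.1, linkStationary_water_zero hs hP0 h.2.2.1,
      rfl, by linarith⟩
  case A_d_rd =>
    exact ⟨1, linkStationary_water_zero hg hP0 h.2.2.1, linkStationary_water hs h.1 h.2.1,
      rfl, by linarith⟩
  case A_r_rd =>
    exact ⟨1, linkStationary_water_full hg hP0 h.2.2.1, linkStationary_water hs h.1 h.2.1,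
      rfl, by linarith⟩
  case A_rd_r =>
    exact ⟨1, linkStationary_water hg h.1 h.2.1, linkStationary_water_full hs hP0 h.2.2.1,
      rfl, by linarith⟩
  case A_rd_rd =>
    exact ⟨1, linkStationary_water hg h.1 h.2.2.1, linkStationary_water hs h.2.1 h.2.2.2.1,
      rfl, by linarith⟩
  case S_r_rd =>
    obtain ⟨t, ht, h1, h2⟩ := linkStationary_S_r_rd hg hP h.1 h.2.1 h.2.2.1 h.2.2.2
    refine ⟨t, h1, h2, ht, ?_⟩
    change _ * (1 + g.r2 * (g.r2⁻¹ * (γ / relayMax g P - 1))) = γ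
    have : relayMax g P ≠ 0 := by linarith
    field_simp
    ring
  case S_rd_r =>
    obtain ⟨t, ht, h1, h2⟩ := linkStationary_S_r_rd hs hP (by rw [mul_comm]; exact h.1) h.2.1
      h.2.2.1 h.2.2.2
    refine ⟨t, h2, h1, ht, ?_⟩
    change (1 + g.r1 * (g.r1⁻¹ * (γ / relayMax g.swap P - 1))) * _ = γ
    have : relayMax g.swap P ≠ 0 := by linarith
    field_simp
    ring
  case S_rd_d =>
    obtain ⟨t, ht, h1, h2⟩ := linkStationary_S_rd_d hg hP hγ h.1 h.2.1 h.2.2.le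
    refine ⟨t, h1, h2, ht, ?_⟩
    field_simp
    ring
  case S_d_rd =>
    obtain ⟨t, ht, h1, h2⟩ := linkStationary_S_rd_d hs hP hγ h.1 h.2.1 h.2.2.le
    refine ⟨t, h2, h1, ht, ?_⟩
    field_simp
    ring
  case S_rd_rd =>
    obtain ⟨h1, h2, h3, h4, h5⟩ := h
    have t1 := linkTotal_pos hg hP
    have t2 := linkTotal_pos hs hP
    have h4' : linkTotal g P ≤ γ * linkTotal g.swap P := not_lt.1 (mt onlySourceOne_of_lt h4)
    have h5' : linkTotal g.swap P ≤ γ * linkTotal g P :=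
      not_lt.1 (mt (onlySourceOne_of_lt (g := g.swap)) h5)
    -- both sources use the fraction `m` of their totals
    obtain ⟨m, hm⟩ : ∃ m, m = √(γ / (linkTotal g P * linkTotal g.swap P)) := ⟨_, rfl⟩
    have hm0 : 0 ≤ m := hm ▸ Real.sqrt_nonneg _
    have hmm : m * m = γ / (linkTotal g P * linkTotal g.swap P) := by
      rw [hm, Real.mul_self_sqrt (by positivity)]
    have hm2 : m ≤ 1 / 2 := by
      rw [hm, Real.sqrt_le_iff, div_le_iff₀ (by positivity)]
      exact ⟨by norm_num, by linarith⟩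
    have hden : 0 < 1 - m := by linarith
    refine ⟨m / (1 - m), linkStationary_S_rd_rd hg hP hm (by linarith) h5' h2,
      linkStationary_S_rd_rd hs hP (by rw [hm, mul_comm]; rfl) (by linarith) h4' h1,
      ⟨div_nonneg hm0 hden.le, (div_le_one hden).2 (by linarith)⟩, ?_⟩
    have e1 : 1 + g.r1 * sq1 γ g P = linkTotal g P * m := by
      rw [sq_eq hg, sqrt_mul_div_eq t1 t2, hm]
    have e2 : 1 + g.r2 * sq2 γ g P = linkTotal g.swap P * m := by
      refine (sq_eq hs).trans ?_
      rw [sqrt_mul_div_eq t2 (linkTotal_pos hs.swap hP), hm,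
        mul_comm (linkTotal g.swap P) (linkTotal _ _)]
      rfl
    rw [e1, e2, mul_mul_mul_comm, hmm, mul_div_cancel₀ _ (by positivity)]

end Stationary

/-! ### Regimes at every budget -/

section Regimes

variable {γ P : ℝ} {g : LinkGains}

theorem LGR.existsUnique_holds_of_pos (hg : g.Pos) (hγ : 1 < γ) (hP : 0 < P) :
    ∃! l : LGR, l.Holds γ g P := by
  simp only [holds_iff_normal hg hγ hP]
  exact existsUnique_normal hγ (one_lt_relayMax hg hP) (relayMax_lt_linkTotal hg)
    (one_lt_relayMax hg.swap hP) (relayMax_lt_linkTotal hg.swap) OnlySourceOne.le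
    onlySourceOne_of_lt OnlySourceOne.le (onlySourceOne_of_lt (g := g.swap))

/-- With an empty budget only the four regimes without power splits can hold, and they are told
apart by the better link of each source. -/
theorem LGR.holds_zero_iff (hg : g.Pos) (hγ : 1 < γ) (l : LGR) : l.Holds γ g 0 ↔
    (l = .A_d_d ∧ 0 ≤ P_d_d g ∧ 0 ≤ Phat_d_d g) ∨ (l = .A_d_r ∧ 0 ≤ P_d_d g ∧ Phat_d_d g ≤ 0) ∨
    (l = .A_r_d ∧ P_d_d g ≤ 0 ∧ 0 ≤ Phat_d_d g) ∨ (l = .A_r_r ∧ P_d_d g ≤ 0 ∧ Phat_d_d g ≤ 0) := by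
  have c1 : 0 < P_r_d γ g := mul_pos (by linarith) (inv_pos.2 hg.r1)
  have c2 : 0 < P_d_r γ g := mul_pos (by linarith) (inv_pos.2 hg.r2)
  have f : 0 ≤ P_r_r γ g := posRoot_nonneg _
  have j : 0 ≤ P_rd_rd γ g := posRoot_nonneg _
  have k : 0 ≤ Pbar_r_rd γ g := posRoot_nonneg _
  cases l <;> simp only [Holds, le_min_iff, max_lt_iff, reduceCtorEq, false_and, or_false,
    false_or, true_and, le_refl, Left.nonneg_neg_iff, Left.neg_neg_iff, c1.le, c2.le, f, and_true,
    iff_false]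
  case A_d_r => exact and_comm
  case A_rd_d => rintro ⟨⟨h, h'⟩, -⟩; linarith
  case A_d_rd => rintro ⟨⟨h, h'⟩, -⟩; linarith
  case A_r_rd => rintro ⟨⟨h, h'⟩, -⟩; linarith
  case A_rd_r => rintro ⟨⟨h, h'⟩, -⟩; linarith
  case A_rd_rd => rintro ⟨⟨⟨h, -⟩, h', -⟩, -⟩; linarith
  case S_r_rd => rintro ⟨⟨h, -⟩, -⟩; linarith
  case S_rd_r => rintro ⟨⟨h, -⟩, -⟩; linarith
  case S_rd_d => rintro (⟨-, ⟨h, -⟩, -⟩ | ⟨-, ⟨h, -⟩, -⟩) <;> linarith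
  case S_d_rd => rintro (⟨-, ⟨h, -⟩, -⟩ | ⟨-, ⟨h, -⟩, -⟩) <;> linarith
  case S_rd_rd => rintro ⟨⟨-, h⟩, -⟩; linarith

theorem LGR.exists_holds_zero (hg : g.Pos) (hγ : 1 < γ) : ∃ l : LGR, l.Holds γ g 0 := by
  simp only [holds_zero_iff hg hγ]
  rcases le_total 0 (P_d_d g) with h | h <;> rcases le_total 0 (Phat_d_d g) with h' | h'
  · exact ⟨_, Or.inl ⟨rfl, h, h'⟩⟩
  · exact ⟨_, Or.inr (Or.inl ⟨rfl, h, h'⟩)⟩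
  · exact ⟨_, Or.inr (Or.inr (Or.inl ⟨rfl, h, h'⟩))⟩
  · exact ⟨_, Or.inr (Or.inr (Or.inr ⟨rfl, h, h'⟩))⟩

theorem LGR.existsUnique_holds_zero (hg : g.Pos) (hγ : 1 < γ) (h1 : g.r1 ≠ g.d1)
    (h2 : g.r2 ≠ g.d2) : ∃! l : LGR, l.Holds γ g 0 := by
  refine existsUnique_of_exists_of_unique (exists_holds_zero hg hγ) fun l l' h h' => ?_
  have h1' : P_d_d g ≠ 0 := sub_ne_zero.2 (inv_injective.ne h1)
  have h2' : Phat_d_d g ≠ 0 := sub_ne_zero.2 (inv_injective.ne h2)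
  rw [holds_zero_iff hg hγ] at h h'
  rcases h with ⟨rfl, a, b⟩ | ⟨rfl, a, b⟩ | ⟨rfl, a, b⟩ | ⟨rfl, a, b⟩ <;>
    rcases h' with ⟨rfl, a', b'⟩ | ⟨rfl, a', b'⟩ | ⟨rfl, a', b'⟩ | ⟨rfl, a', b'⟩ <;>
    first
    | rfl
    | exact absurd (le_antisymm a a') h1'
    | exact absurd (le_antisymm a' a) h1'
    | exact absurd (le_antisymm b b') h2'
    | exact absurd (le_antisymm b' b) h2'

theorem LGR.Holds.regimeStationary_zero (hg : g.Pos) (hγ : 1 < γ) {l : LGR} (h : l.Holds γ g 0) :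
    RegimeStationary γ g 0 l := by
  have hL : ∀ r d : ℝ, LinkStationary r d 0 1 0 := fun r d =>
    ⟨le_rfl, le_rfl, fun x h1 h2 => by simp [le_antisymm h2 h1]⟩
  rw [holds_zero_iff hg hγ] at h
  rcases h with ⟨rfl, -⟩ | ⟨rfl, -⟩ | ⟨rfl, -⟩ | ⟨rfl, -⟩ <;>
    exact ⟨1, hL _ _, hL _ _, fun _ => ⟨rfl, by simpa [alloc, relayProduct] using hγ.le⟩,
      fun h => h.elim⟩

theorem LGR.Holds.regimeStationary (hg : g.Pos) (hγ : 1 < γ) (hP : 0 ≤ P) {l : LGR}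
    (h : l.Holds γ g P) : RegimeStationary γ g P l := by
  rcases hP.eq_or_lt with rfl | hP
  · exact h.regimeStationary_zero hg hγ
  · exact ((holds_iff_normal hg hγ hP l).1 h).regimeStationary hg hγ hP

theorem RegimeStationary.isOptimalAllocation {σR σD α : ℝ} (hg : g.Pos) (hα : 0 < α)
    (hσR : 0 ≤ σR) (hσD : 0 ≤ σD) (hγ : γ = gammaOf σR σD α) {l : LGR}
    (h : RegimeStationary γ g P l) : IsOptimalAllocation σR σD α g P (l.alloc γ g P) := by
  obtain ⟨t, h1, h2, hA, hS⟩ := h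
  refine isOptimalAllocation_of_stationary hg hα hσR hσD hγ (alloc_p1 l) (alloc_p2 l) h1 h2 ?_
  by_cases s : l.IsSaturation
  · exact Or.inr (Or.inl ⟨(hS s).1.1, (hS s).1.2, (hS s).2⟩)
  · exact Or.inl (hA s)

end Regimes

end DRMARC
open DRMARC

theorem mainTheorem4 {Ω : Type*} [MeasurableSpace Ω] (μ : Measure Ω) [IsProbabilityMeasure μ]
    (B : MicrowaveBand Ω) (hB : B.Admissible μ)
    (α gRD PbarR : ℝ) (hα : 0 < α) (hgRD : 0 ≤ gRD) (hPbarR : 0 ≤ PbarR)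
    (g : LinkGains) (hg : g.Pos)
    (σR σD γ : ℝ) (hσR : σR = sigmaR μ B) (hσD : σD = sigmaD μ B α gRD PbarR)
    (hγ : γ = gammaOf σR σD α) :
    (γ ≤ 1 → ∀ P : ℝ, 0 ≤ P → IsOptimalAllocation σR σD α g P ⟨P, 0, P, 0⟩) ∧
    (1 < γ →
      -- the regimes cover all budgets, and the allocation of each regime is the optimal one
      (∀ P : ℝ, 0 ≤ P →
        (∃ ℓ : LGR, ℓ.Holds γ g P) ∧
        ((0 < P ∨ (g.r1 ≠ g.d1 ∧ g.r2 ≠ g.d2)) → ∃! ℓ : LGR, ℓ.Holds γ g P) ∧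
        ∀ ℓ : LGR, ℓ.Holds γ g P →
          IsOptimalAllocation σR σD α g P (ℓ.alloc γ g P) ∧
          (¬ ℓ.IsSaturation → relayProduct g (ℓ.alloc γ g P) ≤ γ) ∧
          (ℓ.IsSaturation → relayProduct g (ℓ.alloc γ g P) = γ)) ∧
      -- the final regime
      (R1 γ g ∨ R2 γ g →
        Pfin_rd_rd γ g < ⊤ ∧
        ∀ P : ℝ, Pfin_rd_rd γ g < (P : EReal) → LGR.S_rd_rd.Holds γ g P) ∧
      (RS1 γ g → Pbar_rd_d γ g ≠ ⊤ →
        Pfin_rd_d γ g < ⊤ ∧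
        ∀ P : ℝ, Pfin_rd_d γ g < (P : EReal) → LGR.S_rd_d.Holds γ g P) ∧
      (RS2 γ g → Pbar_d_rd γ g ≠ ⊤ →
        Pfin_d_rd γ g < ⊤ ∧
        ∀ P : ℝ, Pfin_d_rd γ g < (P : EReal) → LGR.S_d_rd.Holds γ g P) ∧
      -- the degenerate ties with an infinite threshold
      (RS1 γ g → Pbar_rd_d γ g = ⊤ → ∃ P₀ : ℝ, ∀ P : ℝ, P₀ < P → LGR.S_rd_rd.Holds γ g P) ∧
      (RS2 γ g → Pbar_d_rd γ g = ⊤ → ∃ P₀ : ℝ, ∀ P : ℝ, P₀ < P → LGR.S_rd_rd.Holds γ g P)) := by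
  have hσR0 : 0 ≤ σR := hσR ▸ sigmaR_nonneg μ hB
  have hσD0 : 0 ≤ σD := hσD ▸ sigmaD_nonneg μ hB hα hgRD hPbarR
  refine ⟨fun h1 P hP => ?_, fun h1 => ⟨fun P hP => ⟨?_, ?_, fun l hl => ?_⟩, ?_, ?_, ?_, ?_, ?_⟩⟩
  · -- without a gain from relaying, the multiplier `0` certifies that both relay links stay unused
    exact isOptimalAllocation_of_stationary (t := 0) hg hα hσR0 hσD0 hγ (by simp) (by simp)
      (.zero hP (by simpa using hg.d1.le)) (.zero hP (by simpa using hg.d2.le))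
      (Or.inr (Or.inr ⟨rfl, by simpa [relayProduct] using h1⟩))
  · rcases hP.eq_or_lt with rfl | hP
    · exact LGR.exists_holds_zero hg h1
    · exact (LGR.existsUnique_holds_of_pos hg h1 hP).exists
  · intro h
    rcases hP.eq_or_lt with rfl | hP
    · obtain ⟨h2, h3⟩ := h.resolve_left (lt_irrefl 0)
      exact LGR.existsUnique_holds_zero hg h1 h2 h3
    · exact LGR.existsUnique_holds_of_pos hg h1 hP
  · have hst := hl.regimeStationary hg h1 hP
    refine ⟨hst.isOptimalAllocation hg hα hσR0 hσD0 hγ, ?_⟩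
    obtain ⟨t, -, -, hA, hS⟩ := hst
    exact ⟨fun s => (hA s).2, fun s => (hS s).2⟩
  · intro hR
    obtain ⟨n1, n2⟩ := (R1_or_R2_iff hg h1).1 hR
    have e1 : g.r1 - γ * g.r2 ≠ 0 := fun h => n1 (show γ * g.r2 ≤ g.r1 by linarith)
    have e2 : g.r2 - γ * g.r1 ≠ 0 := fun h => n2 (show γ * g.r1 ≤ g.r2 by linarith)
    constructor
    · rw [Pfin_rd_rd, Pbar_rd_d, Pbar_d_rd, extQuot_of_ne e1, extQuot_of_ne e2]
      exact max_lt (max_lt (EReal.coe_lt_top _) (EReal.coe_lt_top _)) (EReal.coe_lt_top _)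
    · intro P h
      rw [Pfin_rd_rd, max_lt_iff, EReal.coe_lt_coe_iff] at h
      exact ⟨h.2, Or.inl ⟨hR, h.1⟩⟩
  · intro hR hne
    refine ⟨max_lt (EReal.coe_lt_top _) (lt_top_iff_ne_top.2 hne), fun P h => ?_⟩
    rw [Pfin_rd_d, max_lt_iff, EReal.coe_lt_coe_iff] at h
    exact Or.inl ⟨hR, h⟩
  · intro hR hne
    refine ⟨max_lt (EReal.coe_lt_top _) (lt_top_iff_ne_top.2 hne), fun P h => ?_⟩
    rw [Pfin_d_rd, max_lt_iff, EReal.coe_lt_coe_iff] at h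
    exact Or.inl ⟨hR, h⟩
  · intro hR htop
    have n2 : ¬ RS2 γ g := (not_RS2_iff hg h1).2 (Or.inr (Or.inr hR))
    have e2 : g.r2 - γ * g.r1 ≠ 0 := fun h => n2 (show γ * g.r1 ≤ g.r2 by linarith)
    refine ⟨max (max (max (Pbar_rd_r γ g) (Pbar_r_rd γ g)) (P_rd_rd γ g))
      ((γ - 1 + γ * g.r1 * g.d1⁻¹ - g.r2 * g.d2⁻¹) / (g.r2 - γ * g.r1)), fun P h => ?_⟩
    rw [max_lt_iff] at h
    refine ⟨h.1, Or.inr (Or.inl ⟨hR, ?_, htop ▸ le_top⟩)⟩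
    rw [Pbar_d_rd, extQuot_of_ne e2]
    exact EReal.coe_lt_coe_iff.2 h.2
  · intro hR htop
    have n1 : ¬ RS1 γ g := (not_RS1_iff hg h1).2 (Or.inr (Or.inr hR))
    have e1 : g.r1 - γ * g.r2 ≠ 0 := fun h => n1 (show γ * g.r2 ≤ g.r1 by linarith)
    refine ⟨max (max (max (Pbar_rd_r γ g) (Pbar_r_rd γ g)) (P_rd_rd γ g))
      ((γ - 1 + γ * g.r2 * g.d2⁻¹ - g.r1 * g.d1⁻¹) / (g.r1 - γ * g.r2)), fun P h => ?_⟩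
    rw [max_lt_iff] at h
    refine ⟨h.1, Or.inr (Or.inr ⟨hR, ?_, htop ▸ le_top⟩)⟩
    rw [Pbar_rd_d, extQuot_of_ne e1]
    exact EReal.coe_lt_coe_iff.2 h.2
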